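/- Let $\{\eta_{i,j} : j\in\{i+1,i+2\},\ i\ge 0\}$ be i.i.d. strictly positive random variables with a continuous (atomless) distribution and $\mathbb E\log\eta_{i,j}<\infty$ (that is, $\mathbb E\max\{0,\log\eta_{i,j}\}<\infty$, so that $\mathbb E\log\eta_{i,j}\in[-\infty,\infty)$). Let $\mathcal I_0$ be a (possibly random) magnitude with values in a bounded set of positive reals, and put $\mathcal I_1=\eta_{0,1}\mathcal I_0$ and $\mathcal I_n=\eta_{n-1,n}\mathcal I_{n-1}+\eta_{n-2,n}\mathcal I_{n-2}$ for $n\ge 2$, i.e. $$\begin{bmatrix}\mathcal I_{n-1}\\ \mathcal I_n\end{bmatrix}=\Big(\prod_{i=2}^{n}A_i\Big)\begin{bmatrix}\mathcal I_0\\ \eta_{0,1}\mathcal I_0\end{bmatrix},\qquad A_i=\begin{bmatrix}0&1\\ \eta_{i-2,i}&\eta_{i-1,i}\end{bmatrix},$$ where in all products the factor with the largest index stands on the left. Let $n_0>0$ be the noise variance, let $\kappa\in\{0,n_0\}$, put $\mathcal N_0^2=0$, and for $n\ge 1$ let $\mathcal N_n^2$ be the second coordinate of $$\prod_{i=2}^{n}\begin{bmatrix}0&1&\kappa\\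 \eta_{i-2,i}^2&\eta_{i-1,i}^2&n_0\\ 0&0&1\end{bmatrix}\begin{bmatrix}0\\0\\1\end{bmatrix}$$ (for $\kappa=0$ this says $\mathcal N_0^2=\mathcal N_1^2=0$ and $\mathcal N_n^2=\eta_{n-1,n}^2\mathcal N_{n-1}^2+\eta_{n-2,n}^2\mathcal N_{n-2}^2+n_0$ for $n\ge2$). Let $X_n^2=\mathcal I_n^2+\mathcal N_n^2$ be the transmit power at the $n$-th node, and let $$\lambda=\lim_{m\to\infty}\frac1m\,\mathbb E\log\big\|A_{m+1}A_m\cdots A_2\big\|$$ be the upper Lyapunov exponent of the information signal. Then this limit exists in $[-\infty,\infty)$, and $$X_n^2=\Theta_{\mathbb P}\big(\exp(n\max\{0,2\lambda\})\big).$$ Here $f(n)=\Theta_{\mathbb P}(g(n))$ means that there are nonnegative deterministic sequences $h(n)=o(n)$ and $h'(n)=o(n)$ with $\lim_{n\to\infty}\mathbb P[f(n)\le g(n)e^{h(n)}]=1$ and $\lim_{n\to\infty}\mathbb P[f(n)\ge g(n)e^{-h'(n)}]=1$. -/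

import Mathlib

open MeasureTheory ProbabilityTheory Filter Topology Asymptotics
open scoped Matrix

/-- The hops `(i, j)` of the cooperative network: node `j` hears nodes `j - 1` and `j - 2`. -/
def Hop : Type := {e : ℕ × ℕ // e.2 = e.1 + 1 ∨ e.2 = e.1 + 2}

noncomputable section

/-! ### Probabilistic Landau symbols -/

/-- `f(n) = O_ℙ(g(n))`: for some nonnegative `h(n) = o(n)`, `ℙ[f(n) ≤ g(n) e^{h(n)}] → 1`. -/
def IsBigOP {Ω : Type*} [MeasurableSpace Ω] (μ : Measure Ω) (f : ℕ → Ω → ℝ) (g : ℕ → ℝ) : Prop :=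
  ∃ h : ℕ → ℝ, (∀ n, 0 ≤ h n) ∧ h =o[atTop] (fun n : ℕ => (n : ℝ)) ∧
    Tendsto (fun n : ℕ => μ {ω | f n ω ≤ g n * Real.exp (h n)}) atTop (𝓝 1)

/-- `f(n) = Ω_ℙ(g(n))`: for some nonnegative `h(n) = o(n)`, `ℙ[f(n) ≥ g(n) e^{-h(n)}] → 1`. -/
def IsBigOmegaP {Ω : Type*} [MeasurableSpace Ω] (μ : Measure Ω) (f : ℕ → Ω → ℝ) (g : ℕ → ℝ) :
    Prop :=
  ∃ h : ℕ → ℝ, (∀ n, 0 ≤ h n) ∧ h =o[atTop] (fun n : ℕ => (n : ℝ)) ∧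
    Tendsto (fun n : ℕ => μ {ω | g n * Real.exp (-h n) ≤ f n ω}) atTop (𝓝 1)

/-- `f(n) = Θ_ℙ(g(n))`. -/
def IsBigThetaP {Ω : Type*} [MeasurableSpace Ω] (μ : Measure Ω) (f : ℕ → Ω → ℝ) (g : ℕ → ℝ) :
    Prop :=
  IsBigOP μ f g ∧ IsBigOmegaP μ f g

/-! ### The information signal and its matrix cocycle

A realisation of the gains is a function `a : ℕ → ℕ → ℝ`, `a i j` being the gain of the hop
`(i, j)`. -/

/-- `𝓘_0 = x`, `𝓘_1 = a_{0,1} 𝓘_0`, `𝓘_n = a_{n-1,n} 𝓘_{n-1} + a_{n-2,n} 𝓘_{n-2}`. -/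
def infoMagnitude (a : ℕ → ℕ → ℝ) (x : ℝ) : ℕ → ℝ
  | 0 => x
  | 1 => a 0 1 * x
  | (n + 2) => a (n + 1) (n + 2) * infoMagnitude a x (n + 1) + a n (n + 2) * infoMagnitude a x n

/-- The one-step matrix `[[0, 1], [a_{k,k+2}, a_{k+1,k+2}]]`, taking `(𝓘_k, 𝓘_{k+1})` to
`(𝓘_{k+1}, 𝓘_{k+2})`. -/
def infoMatrix (a : ℕ → ℕ → ℝ) (k : ℕ) : Matrix (Fin 2) (Fin 2) ℝ :=
  !![0, 1; a k (k + 2), a (k + 1) (k + 2)]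

/-- The product of the first `m` one-step matrices, the newest factor on the left. -/
def infoCocycle (a : ℕ → ℕ → ℝ) : ℕ → Matrix (Fin 2) (Fin 2) ℝ
  | 0 => 1
  | (m + 1) => infoMatrix a m * infoCocycle a m

/-- The matrix form of the recursion. -/
theorem infoCocycle_mulVec (a : ℕ → ℕ → ℝ) (x : ℝ) (m : ℕ) :
    infoCocycle a m *ᵥ ![x, a 0 1 * x] = ![infoMagnitude a x m, infoMagnitude a x (m + 1)] := by
  induction m with
  | zero => simp [infoCocycle, infoMagnitude]
  | succ m ih =>
    rw [infoCocycle, ← Matrix.mulVec_mulVec, ih]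
    ext i
    fin_cases i <;> simp [infoMatrix, infoMagnitude, Matrix.mulVec, dotProduct, Fin.sum_univ_two,
      add_comm]

/-! ### The upper Lyapunov exponent -/

/-- The expectation `𝔼 f⁺ - 𝔼 f⁻` in the extended reals; it is only used where `𝔼 f⁺ < ∞`. -/
def extExpectation {Ω : Type*} [MeasurableSpace Ω] (μ : Measure Ω) (f : Ω → ℝ) : EReal :=
  ((∫⁻ ω, ENNReal.ofReal (f ω) ∂μ : ENNReal) : EReal)
    - ((∫⁻ ω, ENNReal.ofReal (-f ω) ∂μ : ENNReal) : EReal)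

section Norm

attribute [local instance] Matrix.linftyOpNormedAddCommGroup

/-- `(1/m) 𝔼 log ‖A_m ⋯ A_1‖`, with `A_m ⋯ A_1` the cocycle of the information signal and `‖·‖`
the maximal absolute row sum (as an operator norm, it is submultiplicative; any other matrix norm
has the same limit). -/
def meanLogGrowth {Ω : Type*} [MeasurableSpace Ω] (μ : Measure Ω) (η : ℕ → ℕ → Ω → ℝ) (m : ℕ) :
    EReal :=
  extExpectation μ (fun ω => Real.log ‖infoCocycle (fun i j => η i j ω) m‖) / (m : EReal)

end Norm

/-- The upper Lyapunov exponent `lim_m (1/m) 𝔼 log ‖A_m ⋯ A_1‖ ∈ [-∞, ∞]`. -/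
def upperLyapunovExponent {Ω : Type*} [MeasurableSpace Ω] (μ : Measure Ω) (η : ℕ → ℕ → Ω → ℝ) :
    EReal :=
  limsup (meanLogGrowth μ η) atTop

/-! ### Noise power and transmit power -/

/-- The one-step matrix of the noise power. The third entry of the first row is a parameter `κ`:
for `κ = 0` the state after `m` steps is `(𝓝_m², 𝓝_{m+1}², 1)`. -/
def noiseMatrix (a : ℕ → ℕ → ℝ) (n₀ κ : ℝ) (k : ℕ) : Matrix (Fin 3) (Fin 3) ℝ :=
  !![0, 1, κ; a k (k + 2) ^ 2, a (k + 1) (k + 2) ^ 2, n₀; 0, 0, 1]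

/-- The product of the first `m` noise matrices, the newest factor on the left. -/
def noiseCocycle (a : ℕ → ℕ → ℝ) (n₀ κ : ℝ) : ℕ → Matrix (Fin 3) (Fin 3) ℝ
  | 0 => 1
  | (m + 1) => noiseMatrix a n₀ κ m * noiseCocycle a n₀ κ m

/-- The noise power `𝓝_n²`: zero for `n = 0`, and for `n ≥ 1` the second coordinate of the
product of the `n - 1` noise matrices of the nodes `2, …, n`, applied to `(0, 0, 1)`. -/
def noisePower (a : ℕ → ℕ → ℝ) (n₀ κ : ℝ) : ℕ → ℝ
  | 0 => 0
  | (m + 1) => (noiseCocycle a n₀ κ m *ᵥ ![0, 0, 1]) 1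

/-- The transmit power `X_n² = 𝓘_n² + 𝓝_n²` at the `n`-th node. -/
def transmitPower (a : ℕ → ℕ → ℝ) (x n₀ κ : ℝ) (n : ℕ) : ℝ :=
  infoMagnitude a x n ^ 2 + noisePower a n₀ κ n

end

/-!
The matrices `A_k` involve disjoint sets of hops, so they are independent and identically
distributed, and `log ‖A_m ⋯ A_1‖` is a subadditive functional of an i.i.d. sequence.

*Growth rate.* For such a functional `f` with `𝔼 f_1⁺ < ∞` suppose that `𝔼 f_k < k c` for one
`k ≥ 1`. Cutting `[0, n)` into blocks of length `k` and applying the `L¹` law of large numbers to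
the blocks (truncated from below, as the expectation may be `-∞`) gives `𝔼 (f_n - n c)⁺ = o(n)`:
`IsSubadditiveFunctional.tendsto_integral_excess`. Hence the upper limit `l` of `𝔼 f_n / n` is at
most `𝔼 f_k / k` for each `k`, so it is a limit, it is below `+∞`, and `f_n ≤ n c` with probability
tending to one for every `c > l`. If `l` is finite, then also `𝔼 f_n ≥ n l`, and the smallness of
the mean excess `(f_n - n c)⁺` forces the mean deficit to be small. So `f_n ≥ n c` with probability
tending to one for every `c < l` (`IsSubadditiveFunctional.tendsto_measure_lt`), and Kingman's
theorem is not needed.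

*Upper bound.* The noise amplitude satisfies the recursion of the information signal with an input
at every step, because a sum of squares is at most the square of the sum. It is therefore at most
`√n₀` times the sum `growthSum` of the norms of the products over all intervals `[s, m)`
(`HasLogGains.noisePower_le`). A block decomposition in which only positive parts are kept is
uniform in `s`, and the positive part of `f_n / n` has mean converging to at most `max 0 l`, so
`growthSum` grows at rate at most `max 0 l` (`tendsto_measure_log_growthSum_gt`).

*Lower bound.* The noise injected at the last node is at least `n₀`, which settles the case `l ≤ 0`.
If `l > 0`, node `m + 2` hears nodes `m` and `m + 1`, and one of these carries the larger row sum of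
the product. Its information signal is thus at least `‖A_m ⋯ A_1‖` times the smaller of two gains,
whose law does not depend on `m` (`HasLogGains.le_infoMagnitude`).
-/

/-! ### Subadditive functionals of an i.i.d. sequence -/

/-- A subadditive process over the one-sided shift: `f m` is a measurable function of the first `m`
terms of a sequence, and `f (m + n)` is at most `f m` plus `f n` of the sequence shifted by `m`. -/
structure IsSubadditiveFunctional {E : Type*} [MeasurableSpace E] (f : ℕ → (ℕ → E) → ℝ) : Prop where
  measurable : ∀ m, Measurable (f m)
  dependsOn : ∀ m, DependsOn (f m) (Set.Iio m)
  zero : ∀ w, f 0 w = 0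
  add_le : ∀ m n w, f (m + n) w ≤ f m w + f n (fun k => w (k + m))

/-- An independent and identically distributed sequence of measurable functions. -/
structure IsIID {Ω E : Type*} [MeasurableSpace Ω] [MeasurableSpace E] (μ : Measure Ω)
    (W : ℕ → Ω → E) : Prop where
  measurable : ∀ k, Measurable (W k)
  indep : iIndepFun W μ
  ident : ∀ k, IdentDistrib (W k) (W 0) μ μ

section IID

variable {Ω E : Type*} [MeasurableSpace Ω] [MeasurableSpace E] {μ : Measure Ω}
  {W : ℕ → Ω → E} {f : ℕ → (ℕ → E) → ℝ}

theorem IsIID.measurable_shift (hW : IsIID μ W) (s : ℕ) :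
    Measurable (fun ω k => W (k + s) ω) :=
  measurable_pi_lambda _ fun _ => hW.measurable _

theorem IsIID.measurable_seq (hW : IsIID μ W) : Measurable (fun ω k => W k ω) :=
  hW.measurable_shift 0

theorem IsIID.identDistrib_shift (hW : IsIID μ W) (s : ℕ) :
    IdentDistrib (fun ω k => W (k + s) ω) (fun ω k => W k ω) μ μ :=
  IdentDistrib.pi (X := fun k => W (k + s)) (Y := W)
    (fun k => (hW.ident _).trans (hW.ident k).symm)
    (hW.indep.precomp (add_left_injective s)) hW.indep

theorem IsIID.identDistrib_comp_shift (hW : IsIID μ W) {g : (ℕ → E) → ℝ} (hg : Measurable g)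
    (s : ℕ) :
    IdentDistrib (fun ω => g (fun k => W (k + s) ω)) (fun ω => g (fun k => W k ω)) μ μ :=
  (hW.identDistrib_shift s).comp hg

/-- Functions of disjoint blocks of length `k` are independent. -/
theorem IsIID.indepFun_blocks [Nonempty E] (hW : IsIID μ W) {g : (ℕ → E) → ℝ}
    (hg : Measurable g) {k : ℕ} (hdep : DependsOn g (Set.Iio k)) {i j : ℕ} (hij : i ≠ j) :
    IndepFun (fun ω => g (fun r => W (r + i * k) ω)) (fun ω => g (fun r => W (r + j * k) ω)) μ := by
  classical
  obtain ⟨e⟩ := ‹Nonempty E›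
  let G : (s : ℕ) → (Finset.Ico (s * k) (s * k + k) → E) → ℝ := fun s x =>
    g (fun r => if h : r + s * k ∈ Finset.Ico (s * k) (s * k + k) then x ⟨r + s * k, h⟩ else e)
  have hG : ∀ s, Measurable (G s) := by
    intro s
    refine hg.comp (measurable_pi_lambda _ fun r => ?_)
    split_ifs with h
    · exact measurable_pi_apply _
    · exact measurable_const
  have hGW : ∀ s, (fun ω => g (fun r => W (r + s * k) ω)) =
      G s ∘ fun ω (t : Finset.Ico (s * k) (s * k + k)) => W t ω := by
    intro s
    ext ω
    refine hdep fun r hr => ?_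
    have hr' : r < k := hr
    have : r + s * k ∈ Finset.Ico (s * k) (s * k + k) := by
      rw [Finset.mem_Ico]; omega
    simp [this]
  rw [hGW i, hGW j]
  refine (hW.indep.indepFun_finset _ _ ?_ hW.measurable).comp (hG i) (hG j)
  rw [Finset.disjoint_left]
  intro x hx hy
  rw [Finset.mem_Ico] at hx hy
  rcases Nat.lt_or_gt_of_ne hij with h | h
  · have : (i + 1) * k ≤ j * k := Nat.mul_le_mul_right _ h
    rw [add_mul] at this; omega
  · have : (j + 1) * k ≤ i * k := Nat.mul_le_mul_right _ h
    rw [add_mul] at this; omega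

variable [IsProbabilityMeasure μ]

/-- The law of large numbers in `L¹` for functions of consecutive blocks of length `k`. -/
theorem IsIID.tendsto_integral_abs_block_average [Nonempty E] (hW : IsIID μ W)
    {g : (ℕ → E) → ℝ} (hg : Measurable g) {k : ℕ} (hdep : DependsOn g (Set.Iio k))
    (hint : Integrable (fun ω => g (fun r => W r ω)) μ) :
    Tendsto (fun q : ℕ => ∫ ω, |(q : ℝ)⁻¹ * ∑ j ∈ Finset.range q, g (fun r => W (r + j * k) ω)
      - ∫ ω', g (fun r => W r ω') ∂μ| ∂μ) atTop (𝓝 0) := by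
  have key := strong_law_Lp (μ := μ) le_rfl ENNReal.one_ne_top
    (fun j ω => g (fun r => W (r + j * k) ω))
    (by simpa using memLp_one_iff_integrable.2 hint)
    (fun i j hij => hW.indepFun_blocks hg hdep hij)
    (fun j => by simpa using hW.identDistrib_comp_shift hg (j * k))
  rw [← ENNReal.tendsto_toReal_iff (fun q => ?_) (by simp)] at key
  · refine key.congr fun q => ?_
    have hm : AEStronglyMeasurable (fun ω => (q : ℝ)⁻¹ • ∑ j ∈ Finset.range q,
        g (fun r => W (r + j * k) ω) - ∫ ω', g (fun r => W (r + 0 * k) ω') ∂μ) μ := by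
      refine Measurable.aestronglyMeasurable ?_
      exact ((Finset.measurable_sum _ fun j _ =>
        hg.comp (hW.measurable_shift (j * k))).const_smul (q : ℝ)⁻¹).sub_const _
    rw [eLpNorm_one_eq_lintegral_enorm, ← integral_norm_eq_lintegral_enorm hm]
    simp
  · have hi : ∀ j, Integrable (fun ω => g (fun r => W (r + j * k) ω)) μ := fun j =>
      (hW.identDistrib_comp_shift hg (j * k)).symm.integrable_iff.1 hint
    have : Integrable (fun ω => (q : ℝ)⁻¹ • ∑ j ∈ Finset.range q,
        g (fun r => W (r + j * k) ω)) μ :=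
      (integrable_finsetSum (Finset.range q) fun j _ => hi j).smul (q : ℝ)⁻¹
    exact ((memLp_one_iff_integrable.2 (this.sub (integrable_const _))).2).ne

theorem IsSubadditiveFunctional.integrable_posPart (hf : IsSubadditiveFunctional f)
    (hW : IsIID μ W) (h1 : Integrable (fun ω => max (f 1 (fun r => W r ω)) 0) μ) (m : ℕ) :
    Integrable (fun ω => max (f m (fun r => W r ω)) 0) μ := by
  induction m with
  | zero => simp [hf.zero]
  | succ m ih =>
    have h2 := ((hW.identDistrib_comp_shift ((hf.measurable 1).max measurable_const)
      m).integrable_iff).2 h1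
    refine (ih.add h2).mono' ?_ (Eventually.of_forall fun ω => ?_)
    · exact (((hf.measurable _).comp hW.measurable_seq).max measurable_const).aestronglyMeasurable
    · rw [Real.norm_of_nonneg (le_max_right _ _)]
      have := hf.add_le m 1 (fun r => W r ω)
      refine max_le (this.trans ?_) (add_nonneg (le_max_right _ _) (le_max_right _ _))
      exact add_le_add (le_max_left _ _) (le_max_left _ _)

/-- The upper half of the subadditive ergodic theorem, in mean. If a truncation of `f k` has mean
below `k * c` for a single `k ≥ 1`, then the positive part of `f n - n * c` has mean `o(n)`. -/
theorem IsSubadditiveFunctional.tendsto_integral_excess [Nonempty E]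
    (hf : IsSubadditiveFunctional f)
    (hW : IsIID μ W) (h1 : Integrable (fun ω => max (f 1 (fun r => W r ω)) 0) μ)
    {k : ℕ} (hk : 0 < k) {L c : ℝ}
    (hc : ∫ ω, max (f k (fun r => W r ω)) (-L) ∂μ < k * c) :
    Tendsto (fun n : ℕ => (∫ ω, max (f n (fun r => W r ω) - n * c) 0 ∂μ) / n) atTop (𝓝 0) := by
  have hmeas : ∀ n, Measurable fun w => max (f n w - n * c) 0 := fun n =>
    ((hf.measurable n).sub_const _).max measurable_const
  have hint : ∀ n : ℕ, Integrable (fun ω => max (f n (fun r => W r ω) - n * c) 0) μ := by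
    intro n
    refine ((hf.integrable_posPart hW h1 n).add (integrable_const |n * c|)).mono'
      ((hmeas n).comp hW.measurable_seq).aestronglyMeasurable (Eventually.of_forall fun ω => ?_)
    rw [Real.norm_of_nonneg (le_max_right _ _)]
    have h1 := neg_abs_le (n * c)
    have h2 := abs_nonneg (n * c)
    refine max_le ?_ (add_nonneg (le_max_right _ _) h2)
    have := le_max_left (f n (fun r => W r ω)) 0
    rw [Pi.add_apply]
    linarith
  set u : ℕ → ℝ := fun n => ∫ ω, max (f n (fun r => W r ω) - n * c) 0 ∂μ with hu
  have hu0 : ∀ n, 0 ≤ u n := fun n => integral_nonneg fun ω => le_max_right _ _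
  have hsub : Subadditive u := by
    intro m n
    have hid := hW.identDistrib_comp_shift (hmeas n) m
    have hi := hid.integrable_iff.2 (hint n)
    simp only [hu]
    rw [← hid.integral_eq, ← integral_add (hint m) hi]
    refine integral_mono (hint _) ((hint m).add hi) fun ω => ?_
    have := hf.add_le m n (fun r => W r ω)
    simp only [Nat.cast_add]
    refine max_le ?_ (add_nonneg (le_max_right _ _) (le_max_right _ _))
    have h3 := le_max_left (f m (fun r => W r ω) - m * c) 0
    have h4 := le_max_left (f n (fun r => W (r + m) ω) - n * c) 0
    linarith
  have hbdd : BddBelow (Set.range fun n => u n / n) :=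
    ⟨0, by rintro _ ⟨n, rfl⟩; exact div_nonneg (hu0 n) n.cast_nonneg⟩
  have hlim := hsub.tendsto_lim hbdd
  -- along the multiples of `k` the law of large numbers identifies the limit
  let g : (ℕ → E) → ℝ := fun w => max (f k w) (-L)
  have hg : Measurable g := (hf.measurable k).max measurable_const
  have hgdep : DependsOn g (Set.Iio k) := fun x y h => by
    simp only [g, hf.dependsOn k h]
  have hgint : Integrable (fun ω => g (fun r => W r ω)) μ := by
    refine ((hf.integrable_posPart hW h1 k).add (integrable_const |L|)).mono'
      (hg.comp hW.measurable_seq).aestronglyMeasurable (Eventually.of_forall fun ω => ?_)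
    simp only [g, Pi.add_apply, Real.norm_eq_abs]
    have h3 := le_max_left (f k (fun r => W r ω)) 0
    have h4 := le_max_right (f k (fun r => W r ω)) 0
    have h5 := le_abs_self L
    have h6 := neg_abs_le L
    rw [abs_le]
    constructor
    · have := le_max_right (f k (fun r => W r ω)) (-L); linarith
    · exact max_le (by linarith [abs_nonneg L]) (by linarith)
  have hlln := hW.tendsto_integral_abs_block_average hg hgdep hgint
  have hsum : ∀ (q : ℕ) (w : ℕ → E),
      f (q * k) w ≤ ∑ j ∈ Finset.range q, g (fun r => w (r + j * k)) := by
    intro q w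
    induction q with
    | zero => simp [hf.zero]
    | succ q ih =>
      rw [Finset.sum_range_succ, add_mul, one_mul]
      exact (hf.add_le _ _ _).trans (add_le_add ih (le_max_left _ _))
  have hsubseq : Tendsto (fun q : ℕ => u (q * k) / (q * k : ℕ)) atTop (𝓝 0) := by
    refine tendsto_of_tendsto_of_tendsto_of_le_of_le' tendsto_const_nhds hlln
      (Eventually.of_forall fun q => div_nonneg (hu0 _) (Nat.cast_nonneg _)) ?_
    filter_upwards [eventually_gt_atTop 0] with q hq
    have hq' : (0 : ℝ) < q := by exact_mod_cast hq
    have hk' : (1 : ℝ) ≤ k := by exact_mod_cast hk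
    have hsi : Integrable (fun ω => |(q : ℝ)⁻¹ * ∑ j ∈ Finset.range q,
        g (fun r => W (r + j * k) ω) - ∫ ω', g (fun r => W r ω') ∂μ|) μ := by
      refine (Integrable.sub (Integrable.const_mul (integrable_finsetSum _ fun j _ => ?_) _)
        (integrable_const _)).abs
      exact (hW.identDistrib_comp_shift hg (j * k)).integrable_iff.2 hgint
    have hle : u (q * k) ≤ q * ∫ ω, |(q : ℝ)⁻¹ * ∑ j ∈ Finset.range q,
        g (fun r => W (r + j * k) ω) - ∫ ω', g (fun r => W r ω') ∂μ| ∂μ := by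
      rw [← integral_const_mul]
      refine integral_mono (hint _) (hsi.const_mul _) fun ω => ?_
      have h3 := hsum q (fun r => W r ω)
      have h4 := le_abs_self ((q : ℝ)⁻¹ * ∑ j ∈ Finset.range q,
        g (fun r => W (r + j * k) ω) - ∫ ω', g (fun r => W r ω') ∂μ)
      have h5 := mul_le_mul_of_nonneg_left h4 hq'.le
      rw [mul_sub, ← mul_assoc, mul_inv_cancel₀ hq'.ne', one_mul] at h5
      have h6 : (q : ℝ) * ∫ ω', g (fun r => W r ω') ∂μ ≤ q * (k * c) :=
        mul_le_mul_of_nonneg_left hc.le hq'.le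
      refine max_le ?_ (by positivity)
      push_cast
      linarith
    have hA : 0 ≤ ∫ ω, |(q : ℝ)⁻¹ * ∑ j ∈ Finset.range q,
        g (fun r => W (r + j * k) ω) - ∫ ω', g (fun r => W r ω') ∂μ| ∂μ :=
      integral_nonneg fun ω => abs_nonneg _
    rw [div_le_iff₀ (by push_cast; positivity)]
    push_cast
    refine hle.trans ?_
    nlinarith [mul_nonneg hA hq'.le]
  have hcomp := hlim.comp
    (tendsto_id.atTop_mul_const' hk : Tendsto (fun q : ℕ => q * k) atTop atTop)
  rwa [tendsto_nhds_unique hcomp hsubseq] at hlim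

end IID

/-! ### Extended expectations -/

section ExtExpectation

variable {Ω : Type*} [MeasurableSpace Ω] {μ : Measure Ω} {f g : Ω → ℝ}

theorem extExpectation_mono (h : ∀ ω, f ω ≤ g ω) : extExpectation μ f ≤ extExpectation μ g := by
  refine EReal.sub_le_sub ?_ ?_
  · exact EReal.coe_ennreal_le_coe_ennreal_iff.2
      (lintegral_mono fun ω => ENNReal.ofReal_le_ofReal (h ω))
  · exact EReal.coe_ennreal_le_coe_ennreal_iff.2
      (lintegral_mono fun ω => ENNReal.ofReal_le_ofReal (neg_le_neg (h ω)))

theorem extExpectation_congr_ae (h : f =ᵐ[μ] g) : extExpectation μ f = extExpectation μ g := by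
  unfold extExpectation
  congr 2
  · exact lintegral_congr_ae (h.mono fun ω hω => by simp only [hω])
  · exact lintegral_congr_ae (h.mono fun ω hω => by simp only [hω])

theorem lintegral_ofReal_neg_ne_top (hf : Integrable f μ) :
    ∫⁻ ω, ENNReal.ofReal (-f ω) ∂μ ≠ ⊤ :=
  hf.neg.lintegral_lt_top.ne

theorem extExpectation_eq_integral (hf : Integrable f μ) :
    extExpectation μ f = ((∫ ω, f ω ∂μ : ℝ) : EReal) := by
  rw [integral_eq_lintegral_pos_part_sub_lintegral_neg_part hf, EReal.coe_sub,
    EReal.coe_ennreal_toReal hf.lintegral_lt_top.ne,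
    EReal.coe_ennreal_toReal (lintegral_ofReal_neg_ne_top hf), extExpectation]

theorem integrable_posPart_iff (hf : Measurable f) :
    Integrable (fun ω => max (f ω) 0) μ ↔ ∫⁻ ω, ENNReal.ofReal (f ω) ∂μ < ⊤ := by
  have hm : AEStronglyMeasurable (fun ω => max (f ω) 0) μ :=
    (hf.max measurable_const).aestronglyMeasurable
  rw [← lintegral_ofReal_ne_top_iff_integrable hm
    (Eventually.of_forall fun ω => le_max_right _ _), lt_top_iff_ne_top]
  simp

theorem extExpectation_lt_top (hpos : Integrable (fun ω => max (f ω) 0) μ) :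
    extExpectation μ f < ⊤ := by
  have := extExpectation_mono (μ := μ) fun ω => le_max_left (f ω) 0
  rw [extExpectation_eq_integral hpos] at this
  exact this.trans_lt (EReal.coe_lt_top _)

theorem integrable_of_le_extExpectation (hf : Measurable f)
    (hpos : Integrable (fun ω => max (f ω) 0) μ) {a : ℝ} (ha : (a : EReal) ≤ extExpectation μ f) :
    Integrable f μ := by
  have hneg : ∫⁻ ω, ENNReal.ofReal (-f ω) ∂μ ≠ ⊤ := by
    intro h
    rw [extExpectation, h, EReal.coe_ennreal_top, EReal.sub_top] at ha
    exact absurd ha (by simp)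
  have h2 := (integrable_posPart_iff hf.neg).2 hneg.lt_top
  refine (hpos.sub h2).congr (Eventually.of_forall fun ω => ?_)
  simp only [Pi.sub_apply]
  rcases le_total (f ω) 0 with h | h
  · rw [max_eq_right h, max_eq_left (by simpa using h)]; simp
  · rw [max_eq_left h, max_eq_right (by simpa using h)]; simp

/-- A bound on the extended expectation, which may be `-∞`, passes to a truncation from below. -/
theorem exists_integral_max_neg_lt [IsProbabilityMeasure μ] (hf : Measurable f)
    (hpos : Integrable (fun ω => max (f ω) 0) μ) {a : ℝ} (ha : extExpectation μ f < a) :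
    ∃ L : ℝ, ∫ ω, max (f ω) (-L) ∂μ < a := by
  by_contra! hcon
  have hP := (integrable_posPart_iff hf).1 hpos
  set P := ∫⁻ ω, ENNReal.ofReal (f ω) ∂μ with hPdef
  have hN : ∫⁻ ω, ENNReal.ofReal (-f ω) ∂μ = ⨆ n : ℕ, ∫⁻ ω, ENNReal.ofReal (min (-f ω) n) ∂μ := by
    rw [← lintegral_iSup]
    · refine lintegral_congr fun ω => le_antisymm ?_ ?_
      · obtain ⟨n, hn⟩ := exists_nat_ge (-f ω)
        exact le_iSup_of_le n (by rw [min_eq_left hn])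
      · exact iSup_le fun n => ENNReal.ofReal_le_ofReal (min_le_left _ _)
    · exact fun n => (hf.neg.min measurable_const).ennreal_ofReal
    · intro m n hmn ω
      exact ENNReal.ofReal_le_ofReal (min_le_min_left _ (by exact_mod_cast hmn))
  have hn : ∀ n : ℕ, ∫⁻ ω, ENNReal.ofReal (min (-f ω) n) ∂μ ≤ ENNReal.ofReal (P.toReal - a) := by
    intro n
    have hint : Integrable (fun ω => max (f ω) (-(n : ℝ))) μ := by
      refine (hpos.add (integrable_const (n : ℝ))).mono'
        (hf.max measurable_const).aestronglyMeasurable (Eventually.of_forall fun ω => ?_)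
      have h0 : (0 : ℝ) ≤ n := n.cast_nonneg
      have h3 := le_max_left (f ω) 0
      have h4 := le_max_right (f ω) 0
      rw [Pi.add_apply, Real.norm_eq_abs, abs_le]
      exact ⟨by linarith [le_max_right (f ω) (-(n : ℝ))], max_le (by linarith) (by linarith)⟩
    have h := hcon n
    rw [integral_eq_lintegral_pos_part_sub_lintegral_neg_part hint] at h
    have e1 : ∀ ω, ENNReal.ofReal (max (f ω) (-(n : ℝ))) = ENNReal.ofReal (f ω) := fun ω => by
      rw [ENNReal.ofReal_max, ENNReal.ofReal_of_nonpos (p := -(n : ℝ)) (by simp)]; simp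
    have e2 : ∀ ω, -max (f ω) (-(n : ℝ)) = min (-f ω) n := fun ω => by
      rw [← min_neg_neg, neg_neg]
    have hfin := lintegral_ofReal_neg_ne_top hint
    simp only [e1, e2] at h hfin
    rw [← ENNReal.ofReal_toReal hfin]
    exact ENNReal.ofReal_le_ofReal (by linarith)
  have hnn : 0 ≤ P.toReal - a := by
    have h := hcon 0
    have h' : ∫ ω, max (f ω) (-0) ∂μ = P.toReal := by
      rw [integral_eq_lintegral_of_nonneg_ae (Eventually.of_forall fun ω => by simp)
        (hf.max measurable_const).aestronglyMeasurable]
      simp [hPdef]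
    linarith
  have hle : ∫⁻ ω, ENNReal.ofReal (-f ω) ∂μ ≤ ENNReal.ofReal (P.toReal - a) :=
    hN ▸ iSup_le hn
  have hNfin := (hle.trans_lt ENNReal.ofReal_lt_top).ne
  rw [extExpectation, ← hPdef, ← EReal.coe_ennreal_toReal hP.ne, ← EReal.coe_ennreal_toReal hNfin,
    ← EReal.coe_sub, EReal.coe_lt_coe_iff] at ha
  have := ENNReal.toReal_le_of_le_ofReal hnn hle
  linarith

end ExtExpectation

/-! ### The growth rate of a subadditive functional -/

section GrowthRate

variable {Ω E : Type*} [MeasurableSpace Ω] {μ : Measure Ω}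
  {W : ℕ → Ω → E} {f : ℕ → (ℕ → E) → ℝ}

/-- The mean growth `𝔼 f_n / n` of a functional of a random sequence, in the extended reals. -/
noncomputable def meanGrowth (μ : Measure Ω) (W : ℕ → Ω → E) (f : ℕ → (ℕ → E) → ℝ) (n : ℕ) :
    EReal :=
  extExpectation μ (fun ω => f n (fun r => W r ω)) / (n : EReal)

/-- The growth rate of a functional: the upper limit of its mean growth. -/
noncomputable def growthRate (μ : Measure Ω) (W : ℕ → Ω → E) (f : ℕ → (ℕ → E) → ℝ) : EReal :=
  limsup (meanGrowth μ W f) atTop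

theorem meanGrowth_lt_iff {n : ℕ} (hn : 0 < n) {c : ℝ} :
    meanGrowth μ W f n < c ↔
      extExpectation μ (fun ω => f n (fun r => W r ω)) < ((n * c : ℝ) : EReal) := by
  rw [meanGrowth, EReal.div_lt_iff (by exact_mod_cast hn) (EReal.natCast_ne_top n), mul_comm]
  norm_cast

variable [MeasurableSpace E] [IsProbabilityMeasure μ]


theorem IsSubadditiveFunctional.integrable_excess (hf : IsSubadditiveFunctional f)
    (hW : IsIID μ W) (h1 : Integrable (fun ω => max (f 1 (fun r => W r ω)) 0) μ) (n : ℕ) (c : ℝ) :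
    Integrable (fun ω => max (f n (fun r => W r ω) - c) 0) μ := by
  refine ((hf.integrable_posPart hW h1 n).add (integrable_const |c|)).mono'
    ((((hf.measurable n).comp hW.measurable_seq).sub_const c).max
      measurable_const).aestronglyMeasurable (Eventually.of_forall fun ω => ?_)
  rw [Real.norm_of_nonneg (le_max_right _ _), Pi.add_apply]
  have h1 := neg_abs_le c
  have h2 := abs_nonneg c
  have := le_max_left (f n (fun r => W r ω)) 0
  exact max_le (by linarith) (add_nonneg (le_max_right _ _) h2)

/-- The upper bound in the subadditive ergodic theorem, in probability. -/
theorem IsSubadditiveFunctional.tendsto_measure_gt (hf : IsSubadditiveFunctional f)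
    (hW : IsIID μ W) (h1 : Integrable (fun ω => max (f 1 (fun r => W r ω)) 0) μ)
    {c c' : ℝ} (hcc : c < c')
    (hc : Tendsto (fun n : ℕ => (∫ ω, max (f n (fun r => W r ω) - n * c) 0 ∂μ) / n) atTop (𝓝 0)) :
    Tendsto (fun n : ℕ => μ {ω | n * c' < f n (fun r => W r ω)}) atTop (𝓝 0) := by
  have hd : 0 < c' - c := sub_pos.2 hcc
  have hlim := hc.div_const (c' - c)
  rw [zero_div] at hlim
  refine (ENNReal.tendsto_toReal_iff (fun n => measure_ne_top _ _) ENNReal.zero_ne_top).1 ?_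
  refine tendsto_of_tendsto_of_tendsto_of_le_of_le' tendsto_const_nhds hlim
    (Eventually.of_forall fun _ => ENNReal.toReal_nonneg) ?_
  filter_upwards [eventually_gt_atTop 0] with n hn
  have hn' : (0 : ℝ) < n := by exact_mod_cast hn
  have hmk := mul_meas_ge_le_integral_of_nonneg
    (Eventually.of_forall fun ω => le_max_right (f n (fun r => W r ω) - n * c) 0)
    (hf.integrable_excess hW h1 n (n * c)) (n * (c' - c))
  have hsub : {ω | n * c' < f n (fun r => W r ω)} ⊆
      {ω | n * (c' - c) ≤ max (f n (fun r => W r ω) - n * c) 0} := by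
    intro ω hω
    rw [Set.mem_ofPred_eq] at hω ⊢
    refine le_trans ?_ (le_max_left _ _)
    linarith
  rw [div_div, le_div_iff₀ (by positivity), mul_comm]
  exact (mul_le_mul_of_nonneg_left (measureReal_mono hsub) (by positivity)).trans hmk

variable [Nonempty E]

theorem IsSubadditiveFunctional.tendsto_excess_of_meanGrowth_lt
    (hf : IsSubadditiveFunctional f)
    (hW : IsIID μ W) (h1 : Integrable (fun ω => max (f 1 (fun r => W r ω)) 0) μ)
    {k : ℕ} (hk : 0 < k) {c : ℝ} (hc : meanGrowth μ W f k < c) :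
    Tendsto (fun n : ℕ => (∫ ω, max (f n (fun r => W r ω) - n * c) 0 ∂μ) / n) atTop (𝓝 0) := by
  obtain ⟨L, hL⟩ := exists_integral_max_neg_lt ((hf.measurable k).comp hW.measurable_seq)
    (hf.integrable_posPart hW h1 k) ((meanGrowth_lt_iff hk).1 hc)
  exact hf.tendsto_integral_excess hW h1 hk hL

/-- The growth rate is a lower bound for the mean growth at every positive time. -/
theorem IsSubadditiveFunctional.growthRate_le_meanGrowth (hf : IsSubadditiveFunctional f)
    (hW : IsIID μ W) (h1 : Integrable (fun ω => max (f 1 (fun r => W r ω)) 0) μ)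
    {k : ℕ} (hk : 0 < k) : growthRate μ W f ≤ meanGrowth μ W f k := by
  refine EReal.le_of_forall_lt_iff_le.1 fun c hc => ?_
  have hlim := hf.tendsto_excess_of_meanGrowth_lt hW h1 hk hc
  have hlim' : Tendsto (fun n : ℕ => ((c + (∫ ω, max (f n (fun r => W r ω) - n * c) 0 ∂μ) / n : ℝ)
      : EReal)) atTop (𝓝 (c : EReal)) := by
    have := hlim.const_add c
    rw [add_zero] at this
    exact (continuous_coe_real_ereal.tendsto c).comp this
  rw [← hlim'.limsup_eq]
  refine limsup_le_limsup ?_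
  filter_upwards [eventually_gt_atTop 0] with n hn
  have hn' : (0 : ℝ) < n := by exact_mod_cast hn
  have hi := hf.integrable_excess hW h1 n (n * c)
  have hle : extExpectation μ (fun ω => f n (fun r => W r ω)) ≤
      ((n * c + ∫ ω, max (f n (fun r => W r ω) - n * c) 0 ∂μ : ℝ) : EReal) := by
    have := extExpectation_eq_integral ((integrable_const (μ := μ) ((n : ℝ) * c)).add hi)
    simp only [Pi.add_apply] at this
    rw [integral_add (integrable_const _) hi, integral_const, probReal_univ, one_smul] at this
    rw [← this]
    refine extExpectation_mono fun ω => ?_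
    have := le_max_left (f n (fun r => W r ω) - n * c) 0
    rw [Pi.add_apply]
    linarith
  rw [meanGrowth, EReal.div_le_iff_le_mul (by exact_mod_cast hn) (EReal.natCast_ne_top n)]
  refine hle.trans (le_of_eq ?_)
  rw [← EReal.coe_natCast, ← EReal.coe_mul]
  congr 1
  field_simp

theorem IsSubadditiveFunctional.tendsto_meanGrowth (hf : IsSubadditiveFunctional f)
    (hW : IsIID μ W) (h1 : Integrable (fun ω => max (f 1 (fun r => W r ω)) 0) μ) :
    Tendsto (meanGrowth μ W f) atTop (𝓝 (growthRate μ W f)) := by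
  refine tendsto_of_le_liminf_of_limsup_le ?_ le_rfl
  refine le_liminf_of_le (by isBoundedDefault) ?_
  filter_upwards [eventually_gt_atTop 0] with n hn
  exact hf.growthRate_le_meanGrowth hW h1 hn

theorem IsSubadditiveFunctional.growthRate_lt_top (hf : IsSubadditiveFunctional f)
    (hW : IsIID μ W) (h1 : Integrable (fun ω => max (f 1 (fun r => W r ω)) 0) μ) :
    growthRate μ W f < ⊤ := by
  refine (hf.growthRate_le_meanGrowth hW h1 one_pos).trans_lt ?_
  rw [meanGrowth, ← EReal.coe_natCast, Nat.cast_one, EReal.div_eq_inv_mul, ← EReal.coe_inv, inv_one,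
    EReal.coe_one, one_mul]
  exact extExpectation_lt_top h1

theorem IsSubadditiveFunctional.tendsto_excess (hf : IsSubadditiveFunctional f)
    (hW : IsIID μ W) (h1 : Integrable (fun ω => max (f 1 (fun r => W r ω)) 0) μ)
    {c : ℝ} (hc : growthRate μ W f < c) :
    Tendsto (fun n : ℕ => (∫ ω, max (f n (fun r => W r ω) - n * c) 0 ∂μ) / n) atTop (𝓝 0) := by
  obtain ⟨k, hk, hkc⟩ := ((eventually_gt_atTop 0).and (eventually_lt_of_limsup_lt hc)).exists
  exact hf.tendsto_excess_of_meanGrowth_lt hW h1 hk hkc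

/-- The lower bound in the subadditive ergodic theorem, in probability. Since the means lie above
the growth rate, the excess being small in mean forces the deficit to be small in mean. -/
theorem IsSubadditiveFunctional.tendsto_measure_lt (hf : IsSubadditiveFunctional f)
    (hW : IsIID μ W) (h1 : Integrable (fun ω => max (f 1 (fun r => W r ω)) 0) μ)
    {l c : ℝ} (hl : growthRate μ W f = l) (hc : c < l) :
    Tendsto (fun n : ℕ => μ {ω | f n (fun r => W r ω) < n * c}) atTop (𝓝 0) := by
  have hd : 0 < l - c := sub_pos.2 hc
  refine (ENNReal.tendsto_toReal_iff (fun n => measure_ne_top _ _) ENNReal.zero_ne_top).1 ?_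
  rw [ENNReal.toReal_zero, Metric.tendsto_atTop']
  intro ε hε
  set δ := (l - c) * ε / 4 with hδ
  have hδ0 : 0 < δ := by positivity
  have hlδ : growthRate μ W f < ((l + δ : ℝ) : EReal) := by
    rw [hl, EReal.coe_lt_coe_iff]; linarith
  have hex := (hf.tendsto_excess hW h1 hlδ).eventually_lt_const hδ0
  obtain ⟨N, hN⟩ := eventually_atTop.1 hex
  refine ⟨N, fun n hnN => ?_⟩
  have hn' : (0 : ℝ) < n := by exact_mod_cast (Nat.zero_le N).trans_lt hnN
  have hu := hN n hnN.le
  rw [div_lt_iff₀ hn'] at hu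
  have hmean : ((n * l : ℝ) : EReal) ≤ extExpectation μ (fun ω => f n (fun r => W r ω)) := by
    have := hf.growthRate_le_meanGrowth hW h1 ((Nat.zero_le N).trans_lt hnN)
    rw [hl, meanGrowth, EReal.le_div_iff_mul_le (by exact_mod_cast hn')
      (EReal.natCast_ne_top n)] at this
    rwa [mul_comm, EReal.coe_mul, EReal.coe_natCast]
  have hint : Integrable (fun ω => f n (fun r => W r ω)) μ :=
    integrable_of_le_extExpectation ((hf.measurable n).comp hW.measurable_seq)
    (hf.integrable_posPart hW h1 n) hmean
  rw [extExpectation_eq_integral hint, EReal.coe_le_coe_iff] at hmean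
  have hexi := hf.integrable_excess hW h1 n (n * (l + δ))
  have hint' : Integrable (fun ω => f n (fun r => W r ω) - n * (l + δ)) μ :=
    hint.sub (integrable_const _)
  have hdi : Integrable (fun ω => max (f n (fun r => W r ω) - n * (l + δ)) 0 -
      (f n (fun r => W r ω) - n * (l + δ))) μ := hexi.sub hint'
  have hdef : ∫ ω, (max (f n (fun r => W r ω) - n * (l + δ)) 0 -
      (f n (fun r => W r ω) - n * (l + δ))) ∂μ ≤ n * (2 * δ) := by
    rw [integral_sub hexi hint', integral_sub hint (integrable_const _),
      integral_const, probReal_univ, one_smul]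
    linarith
  have hmk := mul_meas_ge_le_integral_of_nonneg
    (Eventually.of_forall fun ω => sub_nonneg.2
      (le_max_left (f n (fun r => W r ω) - n * (l + δ)) 0)) hdi (n * (l - c))
  have hsub : {ω | f n (fun r => W r ω) < n * c} ⊆ {ω | n * (l - c) ≤
      max (f n (fun r => W r ω) - n * (l + δ)) 0 - (f n (fun r => W r ω) - n * (l + δ))} := by
    intro ω hω
    rw [Set.mem_ofPred_eq] at hω ⊢
    have h2 := le_max_right (f n (fun r => W r ω) - n * (l + δ)) 0
    have h3 : 0 < n * δ := by positivity
    linarith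
  have h4 := ((mul_le_mul_of_nonneg_left (measureReal_mono (μ := μ) hsub) (by positivity :
    0 ≤ n * (l - c))).trans hmk).trans hdef
  rw [mul_assoc] at h4
  have h5 := le_of_mul_le_mul_left h4 hn'
  rw [Real.dist_eq, sub_zero, abs_of_nonneg ENNReal.toReal_nonneg]
  have h6 : (l - c) * μ.real {ω | f n (fun r => W r ω) < n * c} ≤ (l - c) * (ε / 2) := by
    rw [hδ] at h5; linarith
  have h7 := le_of_mul_le_mul_left h6 hd
  change μ.real {ω | f n (fun r => W r ω) < n * c} < ε
  linarith

end GrowthRate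

/-! ### Matrix products with logarithmic gains -/

section GainProduct

attribute [local instance] Matrix.linftyOpNormedAddCommGroup

/-- The one-step matrix of the information signal as a function of the logarithms of its two gains.
In this parametrisation the gains are positive everywhere, not just almost surely. -/
noncomputable def gainMatrix (v : Fin 2 → ℝ) : Matrix (Fin 2) (Fin 2) ℝ :=
  !![0, 1; Real.exp (v 0), Real.exp (v 1)]

/-- The product of the first `m` one-step matrices of a sequence of logarithmic gains, the newest
factor on the left. -/
noncomputable def gainProduct : ℕ → (ℕ → Fin 2 → ℝ) → Matrix (Fin 2) (Fin 2) ℝ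
  | 0, _ => 1
  | (m + 1), w => gainMatrix (w m) * gainProduct m w

/-- The logarithm of the norm (the maximal absolute row sum) of the product of `m` matrices. -/
noncomputable def logNorm (m : ℕ) (w : ℕ → Fin 2 → ℝ) : ℝ := Real.log ‖gainProduct m w‖

/-- The sum of the norms of the products over all intervals `[s, m)` with `s ≤ m`. It dominates
the accumulated noise, each node `s` contributing noise that travels from `s` to `m`. -/
noncomputable def growthSum (m : ℕ) (w : ℕ → Fin 2 → ℝ) : ℝ :=
  ∑ s ∈ Finset.range (m + 1), ‖gainProduct (m - s) (fun k => w (k + s))‖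

theorem norm_eq_max_row_sum (M : Matrix (Fin 2) (Fin 2) ℝ) :
    ‖M‖ = max (|M 0 0| + |M 0 1|) (|M 1 0| + |M 1 1|) := by
  rw [Matrix.linfty_opNorm_def]
  have : (Finset.univ : Finset (Fin 2)) = {0, 1} := rfl
  rw [this, Finset.sup_insert, Finset.sup_singleton]
  simp

theorem gainProduct_add (m n : ℕ) (w : ℕ → Fin 2 → ℝ) :
    gainProduct (m + n) w = gainProduct n (fun k => w (k + m)) * gainProduct m w := by
  induction n with
  | zero => simp [gainProduct]
  | succ n ih => rw [← add_assoc, gainProduct, ih, gainProduct, mul_assoc, add_comm m n]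

theorem gainProduct_congr {m : ℕ} {w w' : ℕ → Fin 2 → ℝ} (h : ∀ k < m, w k = w' k) :
    gainProduct m w = gainProduct m w' := by
  induction m with
  | zero => rfl
  | succ m ih =>
    rw [gainProduct, gainProduct, h m (Nat.lt_succ_self m), ih fun k hk => h k (by omega)]

theorem gainProduct_nonneg (m : ℕ) (w : ℕ → Fin 2 → ℝ) (i j : Fin 2) :
    0 ≤ gainProduct m w i j := by
  induction m generalizing i j with
  | zero => fin_cases i <;> fin_cases j <;> simp [gainProduct]
  | succ m ih =>
    rw [gainProduct, Matrix.mul_apply]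
    refine Finset.sum_nonneg fun k _ => mul_nonneg ?_ (ih k j)
    fin_cases i <;> fin_cases k <;> simp [gainMatrix, Real.exp_nonneg]

theorem gainProduct_one_one_pos (m : ℕ) (w : ℕ → Fin 2 → ℝ) : 0 < gainProduct m w 1 1 := by
  induction m with
  | zero => simp [gainProduct]
  | succ m ih =>
    rw [gainProduct, Matrix.mul_apply, Fin.sum_univ_two]
    have := gainProduct_nonneg m w 0 1
    simp only [gainMatrix, Matrix.of_apply, Matrix.cons_val]
    positivity

theorem norm_gainProduct_pos (m : ℕ) (w : ℕ → Fin 2 → ℝ) : 0 < ‖gainProduct m w‖ := by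
  rw [norm_pos_iff]
  intro h
  have := gainProduct_one_one_pos m w
  rw [h] at this
  exact lt_irrefl _ this

theorem norm_gainProduct_zero (w : ℕ → Fin 2 → ℝ) : ‖gainProduct 0 w‖ = 1 := by
  simp [gainProduct]

theorem norm_gainProduct_add_le (m n : ℕ) (w : ℕ → Fin 2 → ℝ) :
    ‖gainProduct (m + n) w‖ ≤ ‖gainProduct m w‖ * ‖gainProduct n (fun k => w (k + m))‖ := by
  rw [gainProduct_add, mul_comm]
  exact Matrix.linfty_opNorm_mul _ _

theorem measurable_gainProduct (m : ℕ) (i j : Fin 2) :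
    Measurable fun w => gainProduct m w i j := by
  induction m generalizing i j with
  | zero => exact measurable_const
  | succ m ih =>
    simp only [gainProduct, Matrix.mul_apply]
    refine Finset.measurable_sum _ fun k _ => Measurable.mul ?_ (ih k j)
    fin_cases i <;> fin_cases k <;> simp [gainMatrix] <;> fun_prop

theorem measurable_norm_gainProduct (m : ℕ) : Measurable fun w => ‖gainProduct m w‖ := by
  simp only [norm_eq_max_row_sum, ← Real.norm_eq_abs]
  exact ((measurable_gainProduct m 0 0).norm.add (measurable_gainProduct m 0 1).norm).max
    ((measurable_gainProduct m 1 0).norm.add (measurable_gainProduct m 1 1).norm)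

theorem isSubadditiveFunctional_logNorm : IsSubadditiveFunctional logNorm where
  measurable m := (measurable_norm_gainProduct m).log
  dependsOn m := fun x y h => by
    rw [logNorm, logNorm, gainProduct_congr fun k hk => h k hk]
  zero w := by rw [logNorm, norm_gainProduct_zero, Real.log_one]
  add_le m n w := by
    rw [logNorm, logNorm, logNorm, ← Real.log_mul (norm_gainProduct_pos _ _).ne'
      (norm_gainProduct_pos _ _).ne']
    exact Real.log_le_log (norm_gainProduct_pos _ _) (norm_gainProduct_add_le _ _ _)

theorem norm_gainProduct_le_growthSum (m : ℕ) (w : ℕ → Fin 2 → ℝ) :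
    ‖gainProduct m w‖ ≤ growthSum m w := by
  have := Finset.single_le_sum (f := fun s => ‖gainProduct (m - s) (fun k => w (k + s))‖)
    (fun _ _ => norm_nonneg _) (Finset.mem_range.2 m.succ_pos)
  simp only [Nat.sub_zero, Nat.add_zero] at this
  exact this

theorem one_le_growthSum (m : ℕ) (w : ℕ → Fin 2 → ℝ) : 1 ≤ growthSum m w := by
  have := Finset.single_le_sum (f := fun s => ‖gainProduct (m - s) (fun k => w (k + s))‖)
    (fun _ _ => norm_nonneg _) (Finset.mem_range.2 m.lt_succ_self)
  simp only [Nat.sub_self, norm_gainProduct_zero] at this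
  exact this

theorem growthSum_pos (m : ℕ) (w : ℕ → Fin 2 → ℝ) : 0 < growthSum m w :=
  one_pos.trans_le (one_le_growthSum m w)

/-- The intervals ending at `m + n` start either before `m`, when their product factors through
time `m`, or after `m`. -/
theorem growthSum_add_le (m n : ℕ) (w : ℕ → Fin 2 → ℝ) :
    growthSum (m + n) w ≤ growthSum m w * ‖gainProduct n (fun k => w (k + m))‖ +
      (growthSum n (fun k => w (k + m)) - ‖gainProduct n (fun k => w (k + m))‖) := by
  have e1 : growthSum n (fun k => w (k + m)) - ‖gainProduct n (fun k => w (k + m))‖ =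
      ∑ i ∈ Finset.range n, ‖gainProduct (n - (i + 1)) (fun k => w (k + (i + 1) + m))‖ := by
    rw [growthSum, Finset.sum_range_succ']
    simp
  rw [e1]
  conv_lhs => rw [growthSum, show m + n + 1 = (m + 1) + n by ring, Finset.sum_range_add]
  refine add_le_add ?_ (le_of_eq ?_)
  · rw [growthSum, Finset.sum_mul]
    refine Finset.sum_le_sum fun s hs => ?_
    have hs' : s ≤ m := Nat.lt_succ_iff.1 (Finset.mem_range.1 hs)
    have h := norm_gainProduct_add_le (m - s) n (fun k => w (k + s))
    have e2 : (fun k => w (k + (m - s) + s)) = fun k => w (k + m) := by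
      funext k; congr 1; omega
    rw [show m - s + n = m + n - s by omega] at h
    simpa only [e2] using h
  · refine Finset.sum_congr rfl fun i hi => ?_
    rw [show m + n - (m + 1 + i) = n - (i + 1) by omega]
    congr 2
    funext k
    congr 1
    omega

theorem isSubadditiveFunctional_log_growthSum :
    IsSubadditiveFunctional fun m w => Real.log (growthSum m w) where
  measurable m := by
    refine Measurable.log (Finset.measurable_sum _ fun s _ => ?_)
    exact (measurable_norm_gainProduct (m - s)).comp
      (measurable_pi_lambda _ fun k => measurable_pi_apply _)
  dependsOn m := fun x y h => by
    have : growthSum m x = growthSum m y := Finset.sum_congr rfl fun s hs => by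
      rw [gainProduct_congr fun k hk => h (k + s) (by simp only [Set.mem_Iio]; omega)]
    simp only [this]
  zero w := by simp [growthSum, norm_gainProduct_zero]
  add_le m n w := by
    rw [← Real.log_mul (growthSum_pos _ _).ne' (growthSum_pos _ _).ne']
    refine Real.log_le_log (growthSum_pos _ _) ((growthSum_add_le m n w).trans ?_)
    have h1 := one_le_growthSum m w
    have h2 := norm_gainProduct_le_growthSum n (fun k => w (k + m))
    nlinarith [mul_nonneg (sub_nonneg.2 h1) (sub_nonneg.2 h2)]

theorem log_growthSum_nonneg (m : ℕ) (w : ℕ → Fin 2 → ℝ) : 0 ≤ Real.log (growthSum m w) :=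
  Real.log_nonneg (one_le_growthSum m w)

theorem logNorm_le_log_growthSum (m : ℕ) (w : ℕ → Fin 2 → ℝ) :
    logNorm m w ≤ Real.log (growthSum m w) :=
  Real.log_le_log (norm_gainProduct_pos m w) (norm_gainProduct_le_growthSum m w)

theorem log_growthSum_one_le (w : ℕ → Fin 2 → ℝ) :
    Real.log (growthSum 1 w) ≤ Real.log 3 + (max (w 0 0) 0 + max (w 0 1) 0) := by
  have h0 : (0 : ℝ) ≤ max (w 0 0) 0 := le_max_right _ _
  have h1 : (0 : ℝ) ≤ max (w 0 1) 0 := le_max_right _ _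
  have e0 : Real.exp (w 0 0) ≤ Real.exp (max (w 0 0) 0 + max (w 0 1) 0) :=
    Real.exp_le_exp.2 (by linarith [le_max_left (w 0 0) 0])
  have e1 : Real.exp (w 0 1) ≤ Real.exp (max (w 0 0) 0 + max (w 0 1) 0) :=
    Real.exp_le_exp.2 (by linarith [le_max_left (w 0 1) 0])
  have e2 : 1 ≤ Real.exp (max (w 0 0) 0 + max (w 0 1) 0) := Real.one_le_exp (by linarith)
  have hs : growthSum 1 w = max 1 (Real.exp (w 0 0) + Real.exp (w 0 1)) + 1 := by
    rw [growthSum, Finset.sum_range_succ, Finset.sum_range_one]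
    simp [norm_eq_max_row_sum, gainProduct, gainMatrix]
  rw [Real.log_le_iff_le_exp (growthSum_pos _ _), Real.exp_add, Real.exp_log (by norm_num), hs]
  have : max 1 (Real.exp (w 0 0) + Real.exp (w 0 1)) ≤
      2 * Real.exp (max (w 0 0) 0 + max (w 0 1) 0) := max_le (by linarith) (by linarith)
  linarith

/-- Cutting `[0, q k)` into blocks of length `k`: a product over `[s, q k)` uses an initial segment
of one block, controlled by `K` and the excess of `log growthSum` over `K`, and then whole blocks.
Only nonnegative terms occur, so the bound is uniform in `s`. -/
theorem growthSum_mul_le {K : ℝ} (hK : 0 ≤ K) (k q : ℕ) (w : ℕ → Fin 2 → ℝ) :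
    growthSum (q * k) w ≤ (q + 1) * Real.exp (K + ∑ j ∈ Finset.range q,
      (max (logNorm k (fun r => w (r + j * k))) 0 +
        max (Real.log (growthSum k (fun r => w (r + j * k))) - K) 0)) := by
  induction q with
  | zero => simpa [growthSum, norm_gainProduct_zero] using hK
  | succ q ih =>
    set S := ∑ j ∈ Finset.range q, (max (logNorm k (fun r => w (r + j * k))) 0 +
        max (Real.log (growthSum k (fun r => w (r + j * k))) - K) 0) with hS
    have hS0 : 0 ≤ S := Finset.sum_nonneg fun j _ =>
      add_nonneg (le_max_right _ _) (le_max_right _ _)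
    rw [Finset.sum_range_succ, ← hS, add_mul, one_mul]
    set v : ℕ → Fin 2 → ℝ := fun r => w (r + q * k) with hv
    set y := max (logNorm k v) 0 with hy
    set z := max (Real.log (growthSum k v) - K) 0 with hz
    have hy0 : 0 ≤ y := le_max_right _ _
    have hz0 : 0 ≤ z := le_max_right _ _
    have hN : ‖gainProduct k v‖ ≤ Real.exp (y + z) := by
      rw [← Real.log_le_iff_le_exp (norm_gainProduct_pos _ _)]
      exact (le_max_left (logNorm k v) 0).trans (by linarith)
    have hG : growthSum k v ≤ Real.exp (K + (S + (y + z))) := by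
      rw [← Real.log_le_iff_le_exp (growthSum_pos _ _)]
      have := le_max_left (Real.log (growthSum k v) - K) 0
      linarith
    have h1 := mul_le_mul ih hN (norm_nonneg _) (by positivity)
    rw [mul_assoc, ← Real.exp_add, add_assoc] at h1
    have h2 := growthSum_add_le (q * k) k w
    have h3 := norm_nonneg (gainProduct k v)
    push_cast
    rw [← hv] at h2
    linarith

/-! ### Growth of the sum over all intervals -/

variable {Ω : Type*} [MeasurableSpace Ω] {μ : Measure Ω} {W : ℕ → Ω → Fin 2 → ℝ}

theorem exists_integral_sub_posPart_lt {V : Ω → ℝ} (hV : Integrable V μ) {ε : ℝ} (hε : 0 < ε) :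
    ∃ K : ℝ, 0 ≤ K ∧ ∫ ω, max (V ω - K) 0 ∂μ < ε := by
  have : Tendsto (fun n : ℕ => ∫ ω, max (V ω - n) 0 ∂μ) atTop (𝓝 (∫ _, 0 ∂μ)) := by
    refine tendsto_integral_of_dominated_convergence (fun ω => |V ω|) (fun n => ?_) hV.abs
      (fun n => Eventually.of_forall fun ω => ?_) (Eventually.of_forall fun ω => ?_)
    · exact (hV.aestronglyMeasurable.sub aestronglyMeasurable_const).sup aestronglyMeasurable_const
    · rw [Real.norm_of_nonneg (le_max_right _ _)]
      have : (0 : ℝ) ≤ n := n.cast_nonneg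
      exact max_le (by linarith [le_abs_self (V ω)]) (abs_nonneg _)
    · refine tendsto_const_nhds.congr' ?_
      obtain ⟨N, hN⟩ := exists_nat_ge (V ω)
      filter_upwards [eventually_ge_atTop N] with n hn
      have : (N : ℝ) ≤ n := by exact_mod_cast hn
      exact (max_eq_right (by linarith)).symm
  rw [integral_zero] at this
  obtain ⟨n, hn⟩ := (this.eventually_lt_const hε).exists
  exact ⟨n, n.cast_nonneg, hn⟩

variable [IsProbabilityMeasure μ]

theorem integrable_posPart_log_growthSum_one (hW : IsIID μ W)
    (hpos : ∀ i, Integrable (fun ω => max (W 0 ω i) 0) μ) :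
    Integrable (fun ω => max (Real.log (growthSum 1 (fun r => W r ω))) 0) μ := by
  refine ((integrable_const (Real.log 3)).add ((hpos 0).add (hpos 1))).mono'
    (((isSubadditiveFunctional_log_growthSum.measurable 1).comp hW.measurable_seq).max
      measurable_const).aestronglyMeasurable (Eventually.of_forall fun ω => ?_)
  rw [max_eq_left (log_growthSum_nonneg _ _), Real.norm_of_nonneg (log_growthSum_nonneg _ _)]
  exact log_growthSum_one_le _

theorem integrable_posPart_logNorm_one (hW : IsIID μ W)
    (hpos : ∀ i, Integrable (fun ω => max (W 0 ω i) 0) μ) :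
    Integrable (fun ω => max (logNorm 1 (fun r => W r ω)) 0) μ := by
  refine (integrable_posPart_log_growthSum_one hW hpos).mono'
    (((isSubadditiveFunctional_logNorm.measurable 1).comp hW.measurable_seq).max
      measurable_const).aestronglyMeasurable (Eventually.of_forall fun ω => ?_)
  rw [Real.norm_of_nonneg (le_max_right _ _)]
  exact max_le_max_right _ (logNorm_le_log_growthSum _ _)

/-- The sum over all intervals grows no faster than the positive part of the Lyapunov exponent. -/
theorem tendsto_measure_log_growthSum_gt (hW : IsIID μ W)
    (hpos : ∀ i, Integrable (fun ω => max (W 0 ω i) 0) μ) {c : ℝ} (hc0 : 0 < c)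
    (hc : growthRate μ W logNorm < c) :
    Tendsto (fun n : ℕ => μ {ω | n * c < Real.log (growthSum n (fun r => W r ω))}) atTop (𝓝 0) := by
  have hL := isSubadditiveFunctional_logNorm
  have hG := isSubadditiveFunctional_log_growthSum
  have hL1 := integrable_posPart_logNorm_one hW hpos
  have hG1 := integrable_posPart_log_growthSum_one hW hpos
  -- `growthRate < c₁ < c₂ < c` with `c₁ > 0`
  obtain ⟨r, hr, hrc⟩ := EReal.lt_iff_exists_real_btwn.1 hc
  rw [EReal.coe_lt_coe_iff] at hrc
  set c₁ := max r (c / 2) with hc₁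
  have hc₁c : c₁ < c := max_lt hrc (by linarith)
  have hc₁0 : 0 < c₁ := (half_pos hc0).trans_le (le_max_right _ _)
  have hgr : growthRate μ W logNorm < (c₁ : EReal) :=
    hr.trans_le (EReal.coe_le_coe_iff.2 (le_max_left _ _))
  set δ := (c - c₁) / 8 with hδ
  have hδ0 : 0 < δ := by rw [hδ]; linarith
  obtain ⟨k, hk, hkex⟩ := ((eventually_gt_atTop 0).and
    ((hL.tendsto_excess hW hL1 hgr).eventually_lt_const hδ0)).exists
  have hk' : (0 : ℝ) < k := by exact_mod_cast hk
  rw [div_lt_iff₀ hk'] at hkex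
  have hGint : ∀ n, Integrable (fun ω => Real.log (growthSum n (fun r => W r ω))) μ := fun n =>
    (hG.integrable_posPart hW hG1 n).congr
      (Eventually.of_forall fun ω => max_eq_left (log_growthSum_nonneg _ _))
  obtain ⟨K, hK0, hK⟩ := exists_integral_sub_posPart_lt (hGint k) (mul_pos hδ0 hk')
  let h : (ℕ → Fin 2 → ℝ) → ℝ := fun w =>
    max (logNorm k w) 0 + max (Real.log (growthSum k w) - K) 0
  have hm : Measurable h := ((hL.measurable k).max measurable_const).add
    (((hG.measurable k).sub_const K).max measurable_const)
  have hi1 := hL.integrable_posPart hW hL1 k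
  have hi2 := hG.integrable_excess hW hG1 k K
  have hi : Integrable (fun ω => h (fun r => W r ω)) μ := hi1.add hi2
  have hh : ∫ ω, h (fun r => W r ω) ∂μ ≤ k * (c₁ + 2 * δ) := by
    have hi3 := hL.integrable_excess hW hL1 k (k * c₁)
    have : ∫ ω, max (logNorm k (fun r => W r ω)) 0 ∂μ ≤
        ∫ ω, (max (logNorm k (fun r => W r ω) - k * c₁) 0 + k * c₁) ∂μ := by
      refine integral_mono hi1 (hi3.add (integrable_const _)) fun ω => ?_
      have h1 := le_max_left (logNorm k (fun r => W r ω) - k * c₁) 0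
      have h2 := le_max_right (logNorm k (fun r => W r ω) - k * c₁) 0
      have h3 : 0 < k * c₁ := by positivity
      exact max_le (by linarith) (by linarith)
    rw [integral_add hi3 (integrable_const _), integral_const, probReal_univ, one_smul] at this
    change ∫ ω, (max (logNorm k (fun r => W r ω)) 0 +
      max (Real.log (growthSum k (fun r => W r ω)) - K) 0) ∂μ ≤ _
    rw [integral_add hi1 hi2]
    linarith
  have hmean : ∀ q : ℕ, ∫ ω, Real.log (growthSum (q * k) (fun r => W r ω)) ∂μ ≤
      Real.log (q + 1) + K + q * (k * (c₁ + 2 * δ)) := by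
    intro q
    have hij : ∀ j, Integrable (fun ω => h (fun r => W (r + j * k) ω)) μ := fun j =>
      (hW.identDistrib_comp_shift hm (j * k)).integrable_iff.2 hi
    have his : Integrable (fun ω => ∑ j ∈ Finset.range q, h (fun r => W (r + j * k) ω)) μ :=
      integrable_finsetSum _ fun j _ => hij j
    have hle : ∫ ω, Real.log (growthSum (q * k) (fun r => W r ω)) ∂μ ≤
        ∫ ω, (Real.log (q + 1) + K + ∑ j ∈ Finset.range q, h (fun r => W (r + j * k) ω)) ∂μ := by
      refine integral_mono (hGint _) ((integrable_const _).add his) fun ω => ?_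
      have hq : (0 : ℝ) < q + 1 := by positivity
      have := Real.log_le_log (growthSum_pos _ _) (growthSum_mul_le hK0 k q (fun r => W r ω))
      rw [Real.log_mul hq.ne' (Real.exp_pos _).ne', Real.log_exp] at this
      simp only [h]
      linarith
    rw [integral_add (integrable_const _) his, integral_const, probReal_univ, one_smul,
      integral_finsetSum _ fun j _ => hij j] at hle
    refine hle.trans (add_le_add_right ?_ _)
    rw [Finset.sum_congr rfl fun j _ => (hW.identDistrib_comp_shift hm (j * k)).integral_eq,
      Finset.sum_const, Finset.card_range, nsmul_eq_mul]
    exact mul_le_mul_of_nonneg_left hh q.cast_nonneg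
  -- the logarithmic term and `K` are negligible for a large number `q` of blocks
  obtain ⟨q, hq, hqlog, hqK⟩ : ∃ q : ℕ, 0 < q ∧ Real.log (q + 1) ≤ k * δ * (q + 1) ∧
      k * δ + K < k * δ * q := by
    have hkδ : 0 < k * δ := by positivity
    have h1 : Tendsto (fun q : ℕ => (q : ℝ) + 1) atTop atTop :=
      tendsto_atTop_add_const_right _ _ tendsto_natCast_atTop_atTop
    have h2 := h1.eventually (Real.isLittleO_log_id_atTop.bound hkδ)
    have h3 := (tendsto_natCast_atTop_atTop (R := ℝ)).const_mul_atTop hkδ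
    obtain ⟨q, hq, hq2, hq3⟩ := ((eventually_gt_atTop 0).and
      (h2.and (h3.eventually_gt_atTop (k * δ + K)))).exists
    refine ⟨q, hq, ?_, hq3⟩
    have h0 : (0 : ℝ) ≤ q := q.cast_nonneg
    rw [Real.norm_of_nonneg (Real.log_nonneg (by linarith)), id, Real.norm_of_nonneg
      (by linarith)] at hq2
    exact hq2
  have hqk : ∫ ω, max (Real.log (growthSum (q * k) (fun r => W r ω))) (-0) ∂μ <
      (q * k : ℕ) * (c₁ + 4 * δ) := by
    rw [neg_zero, integral_congr_ae (Eventually.of_forall fun ω =>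
      max_eq_left (log_growthSum_nonneg (q * k) (fun r => W r ω)))]
    refine (hmean q).trans_lt ?_
    push_cast
    linarith
  exact hG.tendsto_measure_gt hW hG1 (by linarith : c₁ + 4 * δ < c)
    (hG.tendsto_integral_excess hW hG1 (Nat.mul_pos hq hk) hqk)

end GainProduct

/-! ### Bounds on the transmit power for a fixed realisation of the gains -/

section Realisation

attribute [local instance] Matrix.linftyOpNormedAddCommGroup

/-- The realisation `a` of the gains has the logarithmic gains `w` on the hops into the nodes
`2, 3, …`; the hop `(0, 1)` only enters the initial condition. -/
def HasLogGains (a : ℕ → ℕ → ℝ) (w : ℕ → Fin 2 → ℝ) : Prop :=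
  ∀ k, a k (k + 2) = Real.exp (w k 0) ∧ a (k + 1) (k + 2) = Real.exp (w k 1)

variable {a : ℕ → ℕ → ℝ} {w : ℕ → Fin 2 → ℝ} {x n₀ κ : ℝ}

theorem HasLogGains.infoCocycle_eq (h : HasLogGains a w) (m : ℕ) :
    infoCocycle a m = gainProduct m w := by
  induction m with
  | zero => rfl
  | succ m ih =>
    rw [infoCocycle, gainProduct, ih, infoMatrix, gainMatrix, (h m).1, (h m).2]

theorem HasLogGains.infoMagnitude_eq (h : HasLogGains a w) (m : ℕ) :
    infoMagnitude a x m = gainProduct m w 0 0 * x + gainProduct m w 0 1 * (a 0 1 * x) ∧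
      infoMagnitude a x (m + 1) =
        gainProduct m w 1 0 * x + gainProduct m w 1 1 * (a 0 1 * x) := by
  have := infoCocycle_mulVec a x m
  rw [h.infoCocycle_eq] at this
  have h0 := congrFun this 0
  have h1 := congrFun this 1
  simp [Matrix.mulVec, dotProduct, Fin.sum_univ_two] at h0 h1
  exact ⟨h0.symm, h1.symm⟩

theorem HasLogGains.infoMagnitude_nonneg (h : HasLogGains a w) (hx : 0 < x) (ha : 0 < a 0 1)
    (m : ℕ) : 0 ≤ infoMagnitude a x m := by
  rw [(h.infoMagnitude_eq m).1]
  have h0 := gainProduct_nonneg m w 0 0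
  have h1 := gainProduct_nonneg m w 0 1
  positivity

theorem HasLogGains.infoMagnitude_le (h : HasLogGains a w) (hx : 0 < x) (m : ℕ) :
    infoMagnitude a x (m + 1) ≤ ‖gainProduct m w‖ * (max 1 (a 0 1) * x) := by
  rw [(h.infoMagnitude_eq m).2, norm_eq_max_row_sum]
  have h0 := gainProduct_nonneg m w 1 0
  have h1 := gainProduct_nonneg m w 1 1
  have hm1 : x ≤ max 1 (a 0 1) * x := le_mul_of_one_le_left hx.le (le_max_left _ _)
  have hma : a 0 1 * x ≤ max 1 (a 0 1) * x := mul_le_mul_of_nonneg_right (le_max_right _ _) hx.le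
  have h2 := le_max_right (|gainProduct m w 0 0| + |gainProduct m w 0 1|)
    (|gainProduct m w 1 0| + |gainProduct m w 1 1|)
  rw [abs_of_nonneg h0, abs_of_nonneg h1] at h2 ⊢
  refine le_trans ?_ (mul_le_mul_of_nonneg_right h2 (hx.le.trans hm1))
  rw [add_mul]
  exact add_le_add (mul_le_mul_of_nonneg_left hm1 h0) (mul_le_mul_of_nonneg_left hma h1)

/-- Node `m + 2` hears both of its predecessors, one of which carries the larger row sum. -/
theorem HasLogGains.le_infoMagnitude (h : HasLogGains a w) (hx : 0 < x) (ha : 0 < a 0 1) (m : ℕ) :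
    Real.exp (min (w m 0) (w m 1)) * (‖gainProduct m w‖ * min x (a 0 1 * x)) ≤
      infoMagnitude a x (m + 2) := by
  have hI0 := h.infoMagnitude_nonneg hx ha m
  have hI1 := h.infoMagnitude_nonneg hx ha (m + 1)
  have hmax : ‖gainProduct m w‖ * min x (a 0 1 * x) ≤
      infoMagnitude a x m + infoMagnitude a x (m + 1) := by
    have hd : 0 ≤ min x (a 0 1 * x) := by positivity
    have hrow : ∀ i, (gainProduct m w i 0 + gainProduct m w i 1) * min x (a 0 1 * x) ≤
        gainProduct m w i 0 * x + gainProduct m w i 1 * (a 0 1 * x) := fun i => by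
      rw [add_mul]
      exact add_le_add
        (mul_le_mul_of_nonneg_left (min_le_left _ _) (gainProduct_nonneg m w i 0))
        (mul_le_mul_of_nonneg_left (min_le_right _ _) (gainProduct_nonneg m w i 1))
    have h0 := hrow 0
    have h1 := hrow 1
    rw [← (h.infoMagnitude_eq m).1] at h0
    rw [← (h.infoMagnitude_eq m).2] at h1
    rw [norm_eq_max_row_sum, max_mul_of_nonneg _ _ hd]
    simp only [abs_of_nonneg (gainProduct_nonneg m w _ _)]
    exact max_le (by linarith) (by linarith)
  refine (mul_le_mul_of_nonneg_left hmax (Real.exp_nonneg _)).trans ?_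
  rw [infoMagnitude, (h m).1, (h m).2, mul_add, add_comm]
  exact add_le_add
    (mul_le_mul_of_nonneg_right (Real.exp_le_exp.2 (min_le_right _ _)) hI1)
    (mul_le_mul_of_nonneg_right (Real.exp_le_exp.2 (min_le_left _ _)) hI0)

/-- The state of the noise recursion after `m` steps. -/
noncomputable def noiseState (a : ℕ → ℕ → ℝ) (n₀ κ : ℝ) (m : ℕ) : Fin 3 → ℝ :=
  noiseCocycle a n₀ κ m *ᵥ ![0, 0, 1]

theorem noiseState_zero : noiseState a n₀ κ 0 = ![0, 0, 1] := by
  simp [noiseState, noiseCocycle]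

theorem noiseState_succ (m : ℕ) :
    noiseState a n₀ κ (m + 1) = noiseMatrix a n₀ κ m *ᵥ noiseState a n₀ κ m := by
  rw [noiseState, noiseCocycle, ← Matrix.mulVec_mulVec, noiseState]

theorem noiseState_two (m : ℕ) : noiseState a n₀ κ m 2 = 1 := by
  induction m with
  | zero => simp [noiseState_zero]
  | succ m ih =>
    rw [noiseState_succ]
    simp [noiseMatrix, Matrix.mulVec, dotProduct, Fin.sum_univ_three, ih]

theorem noiseState_succ_zero (m : ℕ) :
    noiseState a n₀ κ (m + 1) 0 = noiseState a n₀ κ m 1 + κ := by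
  rw [noiseState_succ]
  simp [noiseMatrix, Matrix.mulVec, dotProduct, Fin.sum_univ_three, noiseState_two]

theorem noiseState_succ_one (m : ℕ) :
    noiseState a n₀ κ (m + 1) 1 = a m (m + 2) ^ 2 * noiseState a n₀ κ m 0 +
      a (m + 1) (m + 2) ^ 2 * noiseState a n₀ κ m 1 + n₀ := by
  rw [noiseState_succ]
  simp [noiseMatrix, Matrix.mulVec, dotProduct, Fin.sum_univ_three, noiseState_two]

theorem noiseState_nonneg (hn₀ : 0 ≤ n₀) (hκ : 0 ≤ κ) (m : ℕ) :
    0 ≤ noiseState a n₀ κ m 0 ∧ 0 ≤ noiseState a n₀ κ m 1 := by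
  induction m with
  | zero => simp [noiseState_zero]
  | succ m ih =>
    obtain ⟨h0, h1⟩ := ih
    rw [noiseState_succ_zero, noiseState_succ_one]
    exact ⟨by positivity, by positivity⟩

theorem le_noisePower (hn₀ : 0 ≤ n₀) (hκ : 0 ≤ κ) (m : ℕ) : n₀ ≤ noisePower a n₀ κ (m + 2) := by
  obtain ⟨h0, h1⟩ := noiseState_nonneg (a := a) hn₀ hκ m
  change n₀ ≤ noiseState a n₀ κ (m + 1) 1
  rw [noiseState_succ_one]
  have : 0 ≤ a m (m + 2) ^ 2 * noiseState a n₀ κ m 0 +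
      a (m + 1) (m + 2) ^ 2 * noiseState a n₀ κ m 1 := by positivity
  linarith

theorem noisePower_nonneg (hn₀ : 0 ≤ n₀) (hκ : 0 ≤ κ) (n : ℕ) : 0 ≤ noisePower a n₀ κ n := by
  cases n with
  | zero => exact le_rfl
  | succ m => exact (noiseState_nonneg hn₀ hκ m).2

/-- The solution of the information recursion driven by a unit input at every step. It bounds the
amplitude of the noise, as a sum of squares is at most the square of the sum. -/
noncomputable def noiseEnvelope (w : ℕ → Fin 2 → ℝ) (m : ℕ) : Fin 2 → ℝ :=
  ∑ s ∈ Finset.range m, gainProduct (m - (s + 1)) (fun k => w (k + (s + 1))) *ᵥ 1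

theorem noiseEnvelope_succ (m : ℕ) :
    noiseEnvelope w (m + 1) = gainMatrix (w m) *ᵥ noiseEnvelope w m + 1 := by
  rw [noiseEnvelope, Finset.sum_range_succ, noiseEnvelope, Matrix.mulVec_sum]
  congr 1
  · refine Finset.sum_congr rfl fun s hs => ?_
    have hs' := Finset.mem_range.1 hs
    rw [Matrix.mulVec_mulVec, show m + 1 - (s + 1) = m - (s + 1) + 1 by omega, gainProduct,
      show m - (s + 1) + (s + 1) = m by omega]
  · simp [gainProduct]

theorem noiseEnvelope_nonneg (m : ℕ) (i : Fin 2) : 0 ≤ noiseEnvelope w m i := by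
  rw [noiseEnvelope, Finset.sum_apply]
  refine Finset.sum_nonneg fun s _ => ?_
  rw [Matrix.mulVec, dotProduct]
  exact Finset.sum_nonneg fun j _ => by simpa using gainProduct_nonneg _ _ i j

theorem noiseEnvelope_le_growthSum (m : ℕ) (i : Fin 2) : noiseEnvelope w m i ≤ growthSum m w := by
  rw [noiseEnvelope, Finset.sum_apply, growthSum, Finset.sum_range_succ']
  refine le_add_of_le_of_nonneg (Finset.sum_le_sum fun s _ => ?_) (norm_nonneg _)
  have h1 := norm_le_pi_norm
    (gainProduct (m - (s + 1)) (fun k => w (k + (s + 1))) *ᵥ (1 : Fin 2 → ℝ)) i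
  refine (le_abs_self _).trans (h1.trans ((Matrix.linfty_opNorm_mulVec _ _).trans ?_))
  simp

theorem HasLogGains.noiseState_le (h : HasLogGains a w) (hn₀ : 0 ≤ n₀) (hκ : κ ≤ n₀) (m : ℕ) :
    noiseState a n₀ κ m 0 ≤ n₀ * noiseEnvelope w m 0 ^ 2 ∧
      noiseState a n₀ κ m 1 ≤ n₀ * noiseEnvelope w m 1 ^ 2 := by
  induction m with
  | zero => simp [noiseState_zero, noiseEnvelope]
  | succ m ih =>
    obtain ⟨h0, h1⟩ := ih
    have e0 := noiseEnvelope_nonneg (w := w) m 0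
    have e1 := noiseEnvelope_nonneg (w := w) m 1
    have r0 : noiseEnvelope w (m + 1) 0 = noiseEnvelope w m 1 + 1 := by
      rw [noiseEnvelope_succ]
      simp [gainMatrix, dotProduct, Fin.sum_univ_two]
    have r1 : noiseEnvelope w (m + 1) 1 = Real.exp (w m 0) * noiseEnvelope w m 0 +
        Real.exp (w m 1) * noiseEnvelope w m 1 + 1 := by
      rw [noiseEnvelope_succ]
      simp [gainMatrix, dotProduct, Fin.sum_univ_two]
    rw [noiseState_succ_zero, noiseState_succ_one, (h m).1, (h m).2, r0, r1]
    have g0 := Real.exp_nonneg (w m 0)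
    have g1 := Real.exp_nonneg (w m 1)
    set b := Real.exp (w m 0)
    set c := Real.exp (w m 1)
    set p := noiseEnvelope w m 0
    set q := noiseEnvelope w m 1
    constructor
    · have : 0 ≤ n₀ * (2 * q) := by positivity
      linarith
    · have i0 := mul_le_mul_of_nonneg_left h0 (sq_nonneg b)
      have i1 := mul_le_mul_of_nonneg_left h1 (sq_nonneg c)
      have : 0 ≤ n₀ * (2 * (b * p * (c * q)) + 2 * (b * p) + 2 * (c * q)) := by positivity
      linarith

theorem HasLogGains.noisePower_le (h : HasLogGains a w) (hn₀ : 0 ≤ n₀) (hκ : κ ≤ n₀) (m : ℕ) :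
    noisePower a n₀ κ (m + 1) ≤ n₀ * growthSum m w ^ 2 := by
  refine ((h.noiseState_le hn₀ hκ m).2).trans (mul_le_mul_of_nonneg_left ?_ hn₀)
  exact pow_le_pow_left₀ (noiseEnvelope_nonneg _ _) (noiseEnvelope_le_growthSum _ _) 2

theorem HasLogGains.transmitPower_le (h : HasLogGains a w) (hx : 0 < x) (ha : 0 < a 0 1)
    (hn₀ : 0 ≤ n₀) (hκ : κ ≤ n₀) (m : ℕ) :
    transmitPower a x n₀ κ (m + 1) ≤ growthSum m w ^ 2 * (n₀ + (max 1 (a 0 1) * x) ^ 2) := by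
  have h1 := h.noisePower_le hn₀ hκ m
  have hd : 0 ≤ max 1 (a 0 1) * x := by positivity
  have h2 : infoMagnitude a x (m + 1) ≤ growthSum m w * (max 1 (a 0 1) * x) :=
    (h.infoMagnitude_le hx m).trans
      (mul_le_mul_of_nonneg_right (norm_gainProduct_le_growthSum m w) hd)
  have h3 := pow_le_pow_left₀ (h.infoMagnitude_nonneg hx ha (m + 1)) h2 2
  rw [mul_pow] at h3
  rw [transmitPower]
  linarith

theorem HasLogGains.le_transmitPower (h : HasLogGains a w) (hx : 0 < x) (ha : 0 < a 0 1)
    (hn₀ : 0 ≤ n₀) (hκ : 0 ≤ κ) (m : ℕ) :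
    Real.exp (2 * (min (w m 0) (w m 1) + logNorm m w + Real.log (min x (a 0 1 * x)))) ≤
      transmitPower a x n₀ κ (m + 2) := by
  have hd : 0 < min x (a 0 1 * x) := by positivity
  have h1 := h.le_infoMagnitude hx ha m
  have h2 := noisePower_nonneg (a := a) hn₀ hκ (m + 2)
  have h3 := pow_le_pow_left₀ (mul_nonneg (Real.exp_nonneg _)
    (mul_nonneg (norm_nonneg _) hd.le)) h1 2
  have e : Real.exp (2 * (min (w m 0) (w m 1) + logNorm m w + Real.log (min x (a 0 1 * x)))) =
      (Real.exp (min (w m 0) (w m 1)) * (‖gainProduct m w‖ * min x (a 0 1 * x))) ^ 2 := by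
    rw [mul_comm 2, Real.exp_mul, Real.exp_add, Real.exp_add, logNorm,
      Real.exp_log (norm_gainProduct_pos m w), Real.exp_log hd, mul_assoc]
    norm_cast
  rw [e, transmitPower]
  linarith

end Realisation

/-! ### Convergence in probability and Landau symbols -/

section Landau

variable {Ω : Type*} [MeasurableSpace Ω] {μ : Measure Ω}

/-- A diagonal argument: if `B ε n → 0` for each fixed `ε > 0`, then also along some
`ε = δ n → 0`. -/
theorem exists_tendsto_zero_diagonal {B : ℝ → ℕ → ENNReal} (hB : ∀ n, Antitone fun ε => B ε n)
    (hB1 : ∀ ε n, B ε n ≤ 1) (h : ∀ ε > 0, Tendsto (B ε) atTop (𝓝 0)) :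
    ∃ δ : ℕ → ℝ, (∀ n, 0 ≤ δ n) ∧ Tendsto δ atTop (𝓝 0) ∧
      Tendsto (fun n => B (δ n) n) atTop (𝓝 0) := by
  let A : ℕ → Set ℝ := fun n => {ε | 0 < ε ∧ B ε n ≤ ENNReal.ofReal ε}
  have hA1 : ∀ n, (1 : ℝ) ∈ A n := fun n => ⟨one_pos, by simpa using hB1 1 n⟩
  have hbdd : ∀ n, BddBelow (A n) := fun n => ⟨0, fun ε hε => hε.1.le⟩
  have hinf0 : ∀ n, 0 ≤ sInf (A n) := fun n => le_csInf ⟨1, hA1 n⟩ fun ε hε => hε.1.le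
  have hinf : Tendsto (fun n => sInf (A n)) atTop (𝓝 0) := by
    refine tendsto_order.2 ⟨fun b hb => Eventually.of_forall fun n => hb.trans_le (hinf0 n),
      fun b hb => ?_⟩
    have hb2 : 0 < b / 2 := half_pos hb
    filter_upwards [(h _ hb2).eventually_le_const (ENNReal.ofReal_pos.2 hb2)] with n hn
    exact (csInf_le (hbdd n) ⟨hb2, hn⟩).trans_lt (half_lt_self hb)
  -- a positive correction, since the infimum need not be attained
  have hcor := tendsto_one_div_add_atTop_nhds_zero_nat (𝕜 := ℝ)
  have hδ : Tendsto (fun n : ℕ => sInf (A n) + 1 / ((n : ℝ) + 1)) atTop (𝓝 0) := by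
    simpa using hinf.add hcor
  refine ⟨fun n => sInf (A n) + 1 / ((n : ℝ) + 1), fun n => ?_, hδ, ?_⟩
  · have := hinf0 n
    positivity
  · have hδ' := ENNReal.tendsto_ofReal hδ
    rw [ENNReal.ofReal_zero] at hδ'
    refine tendsto_of_tendsto_of_tendsto_of_le_of_le tendsto_const_nhds hδ'
      (fun n => zero_le) fun n => ?_
    have hlt : sInf (A n) < sInf (A n) + 1 / ((n : ℝ) + 1) :=
      lt_add_of_pos_right _ (by positivity)
    obtain ⟨ε, hε, hεlt⟩ := exists_lt_of_csInf_lt ⟨1, hA1 n⟩ hlt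
    exact (hB n hεlt.le).trans (hε.2.trans (ENNReal.ofReal_le_ofReal hεlt.le))

theorem isLittleO_natCast_mul {δ : ℕ → ℝ} (hδ : Tendsto δ atTop (𝓝 0)) :
    (fun n : ℕ => n * δ n) =o[atTop] (fun n : ℕ => (n : ℝ)) := by
  have := (isBigO_refl (fun n : ℕ => (n : ℝ)) atTop).mul_isLittleO
    ((isLittleO_one_iff ℝ).2 hδ)
  simpa using this

variable [IsProbabilityMeasure μ]

theorem tendsto_measure_one_of_compl {s : ℕ → Set Ω}
    (h : Tendsto (fun n => μ (s n)ᶜ) atTop (𝓝 0)) : Tendsto (fun n => μ (s n)) atTop (𝓝 1) := by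
  have h1 : Tendsto (fun n => 1 - μ (s n)ᶜ) atTop (𝓝 (1 - 0)) :=
    ENNReal.Tendsto.sub tendsto_const_nhds h (Or.inl ENNReal.one_ne_top)
  rw [tsub_zero] at h1
  refine tendsto_of_tendsto_of_tendsto_of_le_of_le h1 tendsto_const_nhds (fun n => ?_)
    fun n => prob_le_one
  rw [tsub_le_iff_right, ← measure_univ (μ := μ), ← Set.union_compl_self (s n)]
  exact measure_union_le _ _

theorem isBigOP_of_forall {f : ℕ → Ω → ℝ} {g : ℕ → ℝ} (hg : ∀ n, 0 ≤ g n)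
    (h : ∀ ε > 0, Tendsto (fun n : ℕ => μ {ω | g n * Real.exp (n * ε) < f n ω}) atTop (𝓝 0)) :
    IsBigOP μ f g := by
  obtain ⟨δ, hδ0, hδ, hlim⟩ := exists_tendsto_zero_diagonal
    (B := fun ε n => μ {ω | g n * Real.exp (n * ε) < f n ω})
    (fun n ε ε' hε => measure_mono fun ω hω => lt_of_le_of_lt (mul_le_mul_of_nonneg_left
      (Real.exp_le_exp.2 (mul_le_mul_of_nonneg_left hε n.cast_nonneg)) (hg n)) hω)
    (fun ε n => prob_le_one) h
  refine ⟨fun n => n * δ n, fun n => mul_nonneg n.cast_nonneg (hδ0 n), isLittleO_natCast_mul hδ,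
    tendsto_measure_one_of_compl (hlim.congr fun n => ?_)⟩
  congr 1
  ext ω
  simp

theorem isBigOmegaP_of_forall {f : ℕ → Ω → ℝ} {g : ℕ → ℝ} (hg : ∀ n, 0 ≤ g n)
    (h : ∀ ε > 0, Tendsto (fun n : ℕ => μ {ω | f n ω < g n * Real.exp (-(n * ε))}) atTop (𝓝 0)) :
    IsBigOmegaP μ f g := by
  obtain ⟨δ, hδ0, hδ, hlim⟩ := exists_tendsto_zero_diagonal
    (B := fun ε n => μ {ω | f n ω < g n * Real.exp (-(n * ε))})
    (fun n ε ε' hε => measure_mono fun ω hω => lt_of_lt_of_le hω (mul_le_mul_of_nonneg_left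
      (Real.exp_le_exp.2 (neg_le_neg (mul_le_mul_of_nonneg_left hε n.cast_nonneg))) (hg n)))
    (fun ε n => prob_le_one) h
  refine ⟨fun n => n * δ n, fun n => mul_nonneg n.cast_nonneg (hδ0 n), isLittleO_natCast_mul hδ,
    tendsto_measure_one_of_compl (hlim.congr fun n => ?_)⟩
  congr 1
  ext ω
  simp

theorem tendsto_measure_gt_atTop {Y : Ω → ℝ} (hY : Measurable Y) {u : ℕ → ℝ}
    (hu : Tendsto u atTop atTop) : Tendsto (fun n => μ {ω | u n < Y ω}) atTop (𝓝 0) := by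
  have h := tendsto_measure_iInter_atTop (μ := μ) (s := fun t : ℝ => {ω | t < Y ω})
    (fun t => (measurableSet_lt measurable_const hY).nullMeasurableSet)
    (fun s t hst ω hω => lt_of_le_of_lt hst hω) ⟨0, measure_ne_top _ _⟩
  have hempty : ⋂ t : ℝ, {ω | t < Y ω} = ∅ := by
    ext ω
    simp only [Set.mem_iInter, Set.mem_empty_iff_false, iff_false, not_forall]
    exact ⟨Y ω, fun h => lt_irrefl (Y ω) h⟩
  rw [hempty, measure_empty] at h
  exact h.comp hu

end Landau

/-! ### The random network -/

section Network

variable {Ω : Type*} [MeasurableSpace Ω] {μ : Measure Ω}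

/-- A doubly indexed independent family, grouped by its first index, is an independent sequence of
vectors. -/
theorem iIndepFun_curry {ι κ E : Type*} [MeasurableSpace E] [IsProbabilityMeasure μ]
    {X : ι → κ → Ω → E} (mX : ∀ i j, Measurable (X i j))
    (h : iIndepFun (fun (p : ι × κ) => X p.1 p.2) μ) :
    iIndepFun (fun i ω j => X i j ω) μ := by
  have hp : ∀ i j, IsProbabilityMeasure (μ.map (X i j)) := fun i j =>
    Measure.isProbabilityMeasure_map (mX i j).aemeasurable
  have hrow : ∀ i, iIndepFun (X i) μ := fun i =>
    h.precomp (g := fun j => (i, j)) (Prod.mk_right_injective i)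
  rw [iIndepFun_iff_map_fun_eq_infinitePi_map fun i => measurable_pi_lambda _ (mX i)]
  have hm : Measurable fun ω (p : ι × κ) => X p.1 p.2 ω :=
    measurable_pi_lambda _ fun p => mX p.1 p.2
  have h1 := (iIndepFun_iff_map_fun_eq_infinitePi_map fun p : ι × κ => mX p.1 p.2).1 h
  have h2 := Measure.infinitePi_map_curry (fun i j => μ.map (X i j))
  rw [← h1, Measure.map_map (MeasurableEquiv.measurable _) hm] at h2
  simp_rw [fun i => (iIndepFun_iff_map_fun_eq_infinitePi_map (mX i)).1 (hrow i)]
  exact h2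

/-- The hop into node `k + 2` from node `k` (for `j = 0`) or from node `k + 1` (for `j = 1`). -/
def hopInto (p : ℕ × Fin 2) : Hop := ⟨(p.1 + p.2, p.1 + 2), by
  obtain ⟨k, j⟩ := p
  fin_cases j <;> simp⟩

theorem hopInto_injective : Function.Injective hopInto := by
  rintro ⟨k, i⟩ ⟨l, j⟩ h
  have h' := congrArg Subtype.val h
  simp only [hopInto, Prod.mk.injEq] at h'
  obtain ⟨h1, h2⟩ := h'
  have hkl : k = l := by omega
  have hij : i = j := by ext; omega
  rw [hkl, hij]

/-- The logarithmic gains of the two hops into node `k + 2`. -/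
noncomputable def logGains (η : ℕ → ℕ → Ω → ℝ) (k : ℕ) (ω : Ω) (j : Fin 2) : ℝ :=
  Real.log (η (k + j) (k + 2) ω)

theorem isIID_logGains [IsProbabilityMeasure μ] {η : ℕ → ℕ → Ω → ℝ}
    (hη_meas : ∀ e : Hop, Measurable (η e.1.1 e.1.2))
    (hη_indep : iIndepFun (fun e : Hop => η e.1.1 e.1.2) μ)
    (hη_ident : ∀ e e' : Hop, IdentDistrib (η e.1.1 e.1.2) (η e'.1.1 e'.1.2) μ μ) :
    IsIID μ (logGains η) := by
  have hm : ∀ (k : ℕ) (j : Fin 2), Measurable fun ω => Real.log (η (k + j) (k + 2) ω) :=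
    fun k j => (hη_meas (hopInto (k, j))).log
  have hind : iIndepFun (fun (p : ℕ × Fin 2) ω => Real.log (η (p.1 + p.2) (p.1 + 2) ω)) μ :=
    (hη_indep.precomp hopInto_injective).comp (fun _ => Real.log) fun _ => Real.measurable_log
  have hrow : ∀ k, iIndepFun (fun (j : Fin 2) ω => Real.log (η (k + j) (k + 2) ω)) μ := fun k =>
    hind.precomp (g := fun j => (k, j)) (Prod.mk_right_injective k)
  refine ⟨fun k => measurable_pi_lambda _ (hm k), iIndepFun_curry hm hind, fun k => ?_⟩
  refine IdentDistrib.pi (fun j => ?_) (hrow k) (hrow 0)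
  exact (hη_ident (hopInto (k, j)) (hopInto (0, j))).comp Real.measurable_log

theorem ae_hasLogGains {η : ℕ → ℕ → Ω → ℝ} (hη_pos : ∀ e : Hop, ∀ᵐ ω ∂μ, 0 < η e.1.1 e.1.2 ω) :
    ∀ᵐ ω ∂μ, HasLogGains (fun i j => η i j ω) (fun k => logGains η k ω) := by
  have h : ∀ᵐ ω ∂μ, ∀ p : ℕ × Fin 2, 0 < η (p.1 + p.2) (p.1 + 2) ω :=
    ae_all_iff.2 fun p => hη_pos (hopInto p)
  filter_upwards [h] with ω hω k
  exact ⟨(Real.exp_log (hω (k, 0))).symm, (Real.exp_log (hω (k, 1))).symm⟩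

theorem meanLogGrowth_eq {η : ℕ → ℕ → Ω → ℝ}
    (hη_pos : ∀ e : Hop, ∀ᵐ ω ∂μ, 0 < η e.1.1 e.1.2 ω) :
    meanLogGrowth μ η = meanGrowth μ (logGains η) logNorm := by
  funext m
  rw [meanLogGrowth, meanGrowth]
  congr 1
  refine extExpectation_congr_ae ?_
  filter_upwards [ae_hasLogGains hη_pos] with ω hω
  rw [hω.infoCocycle_eq, logNorm]

theorem upperLyapunovExponent_eq {η : ℕ → ℕ → Ω → ℝ}
    (hη_pos : ∀ e : Hop, ∀ᵐ ω ∂μ, 0 < η e.1.1 e.1.2 ω) :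
    upperLyapunovExponent μ η = growthRate μ (logGains η) logNorm := by
  rw [upperLyapunovExponent, growthRate, meanLogGrowth_eq hη_pos]

/-- The real number `Λ = max 0 (2 * l)` is either zero or twice `l`; it is zero if `l = -∞`. -/
theorem toReal_max_zero_two_mul {l : EReal} (hl : l < ⊤) :
    0 ≤ (max 0 (2 * l)).toReal ∧ l ≤ (((max 0 (2 * l)).toReal / 2 : ℝ) : EReal) ∧
      ((max 0 (2 * l)).toReal = 0 ∨ l = (((max 0 (2 * l)).toReal / 2 : ℝ) : EReal)) := by
  induction l with
  | bot =>
    have : (2 : EReal) * ⊥ = ⊥ := EReal.mul_bot_of_pos (by norm_num)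
    simp [this]
  | top => exact absurd hl (lt_irrefl _)
  | coe r =>
    have : (max 0 (2 * (r : EReal))).toReal = max 0 (2 * r) := by
      have : max 0 (2 * (r : EReal)) = ((max 0 (2 * r) : ℝ) : EReal) := by
        rw [EReal.coe_strictMono.monotone.map_max, EReal.coe_mul]; rfl
      rw [this, EReal.toReal_coe]
    rw [this, EReal.coe_le_coe_iff, EReal.coe_eq_coe_iff]
    refine ⟨le_max_left _ _, by linarith [le_max_right 0 (2 * r)], ?_⟩
    rcases max_choice 0 (2 * r) with h | h
    · exact Or.inl h
    · right; rw [h]; ring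

end Network

/-! ### The scaling law -/

theorem lemma2 {Ω : Type*} [MeasurableSpace Ω] (μ : Measure Ω) [IsProbabilityMeasure μ]
    -- the gains: i.i.d. over the hops, strictly positive, atomless law, `𝔼 log η ∈ [-∞, ∞)`
    -- (the positive part of `log η` has finite expectation)
    (η : ℕ → ℕ → Ω → ℝ)
    (hη_meas : ∀ e : Hop, Measurable (η e.1.1 e.1.2))
    (hη_indep : iIndepFun (fun e : Hop => η e.1.1 e.1.2) μ)
    (hη_ident : ∀ e e' : Hop, IdentDistrib (η e.1.1 e.1.2) (η e'.1.1 e'.1.2) μ μ)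
    (hη_pos : ∀ e : Hop, ∀ᵐ ω ∂μ, 0 < η e.1.1 e.1.2 ω)
    (hη_cont : ∀ e : Hop, ∀ x : ℝ, μ {ω | η e.1.1 e.1.2 ω = x} = 0)
    (hη_log : ∀ e : Hop, ∫⁻ ω, ENNReal.ofReal (Real.log (η e.1.1 e.1.2 ω)) ∂μ < ⊤)
    -- the source magnitude, with values in a bounded set of positive reals
    (I₀ : Ω → ℝ) (hI₀_meas : Measurable I₀) (S : Set ℝ) (hS_bdd : Bornology.IsBounded S)
    (hS_pos : S ⊆ Set.Ioi 0) (hI₀ : ∀ ω, I₀ ω ∈ S)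
    -- the noise variance, and the two readings of the noise matrix
    (n₀ κ : ℝ) (hn₀ : 0 < n₀) (hκ : κ = 0 ∨ κ = n₀) :
    -- the upper Lyapunov exponent is a genuine limit and is not `+∞`
    Tendsto (meanLogGrowth μ η) atTop (𝓝 (upperLyapunovExponent μ η)) ∧
    upperLyapunovExponent μ η < ⊤ ∧
    -- the scaling law
    IsBigThetaP μ (fun n ω => transmitPower (fun i j => η i j ω) (I₀ ω) n₀ κ n)
      (fun n => Real.exp (n * (max 0 (2 * upperLyapunovExponent μ η)).toReal)) := by
  have hW : IsIID μ (logGains η) := isIID_logGains hη_meas hη_indep hη_ident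
  have hpos : ∀ i, Integrable (fun ω => max (logGains η 0 ω i) 0) μ := fun i =>
    (integrable_posPart_iff (hη_meas (hopInto (0, i))).log).2 (hη_log (hopInto (0, i)))
  have hL := isSubadditiveFunctional_logNorm
  have hL1 := integrable_posPart_logNorm_one hW hpos
  have hgains := ae_hasLogGains hη_pos
  have h01 : ∀ᵐ ω ∂μ, 0 < η 0 1 ω := hη_pos ⟨(0, 1), Or.inl rfl⟩
  have h01m : Measurable (η 0 1) := hη_meas ⟨(0, 1), Or.inl rfl⟩
  have hI₀pos : ∀ ω, 0 < I₀ ω := fun ω => hS_pos (hI₀ ω)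
  have hκ0 : 0 ≤ κ := by rcases hκ with rfl | rfl <;> linarith
  have hκn : κ ≤ n₀ := by rcases hκ with rfl | rfl <;> linarith
  rw [upperLyapunovExponent_eq hη_pos, meanLogGrowth_eq hη_pos]
  have htop := hL.growthRate_lt_top hW hL1
  refine ⟨hL.tendsto_meanGrowth hW hL1, htop, ?_, ?_⟩
  all_goals
    obtain ⟨hΛ0, hΛle, hΛ⟩ := toReal_max_zero_two_mul htop
    set Λ := (max 0 (2 * growthRate μ (logGains η) logNorm)).toReal
  · refine isBigOP_of_forall (fun n => (Real.exp_pos _).le) fun ε hε => ?_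
    rw [← tendsto_add_atTop_iff_nat 1]
    set D : Ω → ℝ := fun ω => n₀ + (max 1 (η 0 1 ω) * I₀ ω) ^ 2 with hD
    have hDm : Measurable D := by
      have := ((measurable_const (a := (1 : ℝ))).max h01m).mul hI₀_meas
      exact (this.pow_const 2).const_add n₀
    have hDpos : ∀ ω, 0 < D ω := fun ω => by positivity
    have hc : growthRate μ (logGains η) logNorm < ((Λ / 2 + ε / 4 : ℝ) : EReal) :=
      hΛle.trans_lt (EReal.coe_lt_coe_iff.2 (by linarith))
    have h1 := tendsto_measure_log_growthSum_gt hW hpos (by positivity : 0 < Λ / 2 + ε / 4) hc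
    have h2 : Tendsto (fun m : ℕ => μ {ω | m * (ε / 2) < Real.log (D ω)}) atTop (𝓝 0) :=
      tendsto_measure_gt_atTop hDm.log
        (tendsto_natCast_atTop_atTop.atTop_mul_const (half_pos hε))
    have h12 := h1.add h2
    rw [add_zero] at h12
    refine tendsto_of_tendsto_of_tendsto_of_le_of_le tendsto_const_nhds h12
      (fun n => zero_le) fun m => ?_
    refine (measure_mono_ae ?_).trans (measure_union_le _ _)
    filter_upwards [hgains, h01] with ω hω hω1 hbad
    by_contra hgood
    have hg1 : ¬ _ := fun h => hgood (Or.inl h)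
    have hg2 : ¬ _ := fun h => hgood (Or.inr h)
    have hbad' : Real.exp ((m + 1 : ℕ) * Λ) * Real.exp ((m + 1 : ℕ) * ε) <
      transmitPower (fun i j => η i j ω) (I₀ ω) n₀ κ (m + 1) := hbad
    have hg1' : Real.log (growthSum m fun r => logGains η r ω) ≤ m * (Λ / 2 + ε / 4) := not_lt.1 hg1
    have hg2' : Real.log (D ω) ≤ m * (ε / 2) := not_lt.1 hg2
    have hle := hω.transmitPower_le (hI₀pos ω) hω1 hn₀.le hκn m
    have hG := growthSum_pos m fun r => logGains η r ω
    have hlt := Real.log_lt_log (by positivity) (hbad'.trans_le hle)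
    rw [← Real.exp_add, Real.log_exp, Real.log_mul (by positivity) (hDpos ω).ne',
      Real.log_pow] at hlt
    push_cast at hlt
    change _ < _ + Real.log (D ω) at hlt
    linarith
  · refine isBigOmegaP_of_forall (fun n => (Real.exp_pos _).le) fun ε hε => ?_
    rw [← tendsto_add_atTop_iff_nat 2]
    rcases hΛ with hΛz | hΛl
    · -- the noise injected at the last node alone is of order one
      refine tendsto_const_nhds.congr' ?_
      have hlin : Tendsto (fun m : ℕ => (m : ℝ) * ε) atTop atTop :=
        tendsto_natCast_atTop_atTop.atTop_mul_const hε
      filter_upwards [hlin.eventually_ge_atTop (-Real.log n₀)] with m hm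
      symm
      rw [hΛz]
      refine measure_mono_null (Eq.subset ?_) (measure_empty (μ := μ))
      refine Set.eq_empty_of_forall_notMem fun ω hω => ?_
      rw [Set.mem_ofPred_eq, mul_zero, Real.exp_zero, one_mul] at hω
      have h1 := le_noisePower (a := fun i j => η i j ω) hn₀.le hκ0 m
      have h2 : Real.exp (-((m + 2 : ℕ) * ε)) ≤ n₀ := by
        rw [← Real.le_log_iff_exp_le hn₀]
        push_cast
        linarith
      rw [transmitPower] at hω
      linarith [sq_nonneg (infoMagnitude (fun i j => η i j ω) (I₀ ω) (m + 2))]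
    · set l := Λ / 2 with hl
      have hε8 : 0 < ε / 8 := by positivity
      have hlin : Tendsto (fun m : ℕ => (m : ℝ) * (ε / 8)) atTop atTop :=
        tendsto_natCast_atTop_atTop.atTop_mul_const hε8
      have h1 := hL.tendsto_measure_lt hW hL1 hΛl (by linarith : l - ε / 8 < l)
      have hmin : Measurable fun v : Fin 2 → ℝ => -min (v 0) (v 1) :=
        ((measurable_pi_apply 0).min (measurable_pi_apply 1)).neg
      have h2 : Tendsto (fun m : ℕ => μ {ω | m * (ε / 8) <
          -min (logGains η m ω 0) (logGains η m ω 1)}) atTop (𝓝 0) := by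
        have h0 := tendsto_measure_gt_atTop (μ := μ) (hmin.comp (hW.measurable 0)) hlin
        refine h0.congr fun m => ?_
        exact (((hW.ident m).comp hmin).measure_mem_eq
          (measurableSet_Ioi (a := m * (ε / 8)))).symm
      have h3 : Tendsto (fun m : ℕ => μ {ω | m * (ε / 8) <
          -Real.log (min (I₀ ω) (η 0 1 ω * I₀ ω))}) atTop (𝓝 0) :=
        tendsto_measure_gt_atTop (hI₀_meas.min (h01m.mul hI₀_meas)).log.neg hlin
      have h123 := (h1.add h2).add h3
      rw [add_zero, add_zero] at h123
      refine tendsto_of_tendsto_of_tendsto_of_le_of_le' tendsto_const_nhds h123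
        (Eventually.of_forall fun n => zero_le) ?_
      filter_upwards [hlin.eventually_ge_atTop (2 * l)] with m hm
      refine (measure_mono_ae ?_).trans ((measure_union_le _ _).trans
        (add_le_add_left (measure_union_le _ _) _))
      filter_upwards [hgains, h01] with ω hω hω1 hbad
      by_contra hgood
      have hg1 : ¬ _ := fun h => hgood (Or.inl (Or.inl h))
      have hg2 : ¬ _ := fun h => hgood (Or.inl (Or.inr h))
      have hg3 : ¬ _ := fun h => hgood (Or.inr h)
      have hbad' : transmitPower (fun i j => η i j ω) (I₀ ω) n₀ κ (m + 2) <
        Real.exp ((m + 2 : ℕ) * Λ) * Real.exp (-((m + 2 : ℕ) * ε)) := hbad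
      have hg1' : m * (l - ε / 8) ≤ logNorm m fun r => logGains η r ω := not_lt.1 hg1
      have hg2' : -min (logGains η m ω 0) (logGains η m ω 1) ≤ m * (ε / 8) := not_lt.1 hg2
      have hg3' : -Real.log (min (I₀ ω) (η 0 1 ω * I₀ ω)) ≤ m * (ε / 8) := not_lt.1 hg3
      have hlt := (hω.le_transmitPower (hI₀pos ω) hω1 hn₀.le hκ0 m).trans_lt hbad'
      rw [← Real.exp_add, Real.exp_lt_exp] at hlt
      push_cast at hlt
      have hΛ2 : Λ = 2 * l := by rw [hl]; ring
      rw [hΛ2] at hlt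
      linarith
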